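/- Let $p\in\mathbb{C}$, $p\neq 0$, and let $\mathcal{S}(p)=\mathcal{S}(p)_{\bar 0}\oplus\mathcal{S}(p)_{\bar 1}$ be the Lie conformal superalgebra which is the free $\mathbb{C}[\partial]$-module with basis $\{L_i,W_i,G_i\mid i\ge 0\}$, with $L_i,W_i$ even and $G_i$ odd, and with the $\lambda$-brackets $$[L_i\,{}_\lambda\,L_j]=\big((i+p)\partial+(i+j+2p)\lambda\big)L_{i+j},\qquad [L_i\,{}_\lambda\,W_j]=\big((i+p)\partial+(i+j+p)\lambda\big)W_{i+j},$$ $$[L_i\,{}_\lambda\,G_j]=\big((i+p)\partial+(i+j+2p)\lambda\big)G_{i+j},\qquad [W_i\,{}_\lambda\,G_j]=G_{i+j},\qquad [W_i\,{}_\lambda\,W_j]=[G_i\,{}_\lambda\,G_j]=0$$ for $i,j\ge 0$, the remaining ones being given by super skew-symmetry. For $n\ge 0$ let $\mathcal{S}(p)_{\langle n\rangle}=\bigoplus_{i\ge n}\big(\mathbb{C}[\partial]L_i\oplus\mathbb{C}[\partial]W_i\oplus\mathbb{C}[\partial]G_i\big)$, which is an ideal of $\mathcal{S}(p)$, and let $\mathcal{S}(p)_{[n]}=\mathcal{S}(p)/\mathcal{S}(p)_{\langle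 n+1\rangle}$ be the quotient Lie conformal superalgebra. Let $V=V_{\bar 0}\oplus V_{\bar 1}$ be a conformal $\mathcal{S}(p)$-module that is finite (that is, finitely generated over $\mathbb{C}[\partial]$) and non-trivial (that is, its $\lambda$-action is not identically zero). Then there is an $N\ge 0$ such that $$L_i\,{}_\lambda\,v=W_i\,{}_\lambda\,v=G_i\,{}_\lambda\,v=0\qquad\text{for all } i\ge N \text{ and all } v\in V.$$ Hence, for all sufficiently large $n$, the Lie conformal superalgebra $\mathcal{S}(p)_{[n]}$ is finite (finitely generated over $\mathbb{C}[\partial]$) and $V$, with the same $\mathbb{Z}/2$-grading, is a conformal module over $\mathcal{S}(p)_{[n]}$ whose $\lambda$-action satisfies $\bar a\,{}_\lambda\,v=a\,{}_\lambda\,v$ for all $a\in\mathcal{S}(p)$ and $v\in V$, where $\bar a$ is the class of $a$ in $\mathcal{S}(p)_{[n]}$. -/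

import Mathlib

open Polynomial

noncomputable section

/-! Conventions.  A `ℂ[∂]`-module is a module over `ℂ[X]`, the indeterminate `X` acting as `∂`.
For a `ℂ[∂]`-module `U`, the space `U[λ] = ℂ[λ] ⊗ U` is `PolynomialModule ℂ[X] U`; it is a module
over `ℂ[X][X] = ℂ[∂][λ]`, in which `C X` is `∂` and `X` is `λ`. -/

/-- The space `U[λ]` of polynomials in `λ` with coefficients in the `ℂ[∂]`-module `U`. -/
abbrev LambdaPoly (U : Type*) [AddCommGroup U] [Module ℂ[X] U] : Type _ :=
  PolynomialModule ℂ[X] U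

/-- The value of a polynomial `P ∈ U[λ]` at the complex number `λ = l`. -/
def LambdaPoly.evalAt {U : Type*} [AddCommGroup U] [Module ℂ[X] U] (l : ℂ) :
    LambdaPoly U →ₗ[ℂ[X]] U :=
  PolynomialModule.eval (C l)

/-- The sign `(-1)^{αβ}` for parities `α`, `β`. -/
def paritySign (α β : ZMod 2) : ℂ := (-1) ^ (α.val * β.val)

/-- The structure of a Lie conformal superalgebra on a `ℂ[∂]`-module `S`: a `ℤ/2`-grading by
`ℂ[∂]`-submodules and a `λ`-bracket `S ⊗ S → S[λ]` that respects it, is sesquilinear,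
super skew-symmetric and satisfies the super Jacobi identity.  The Jacobi identity, an identity of
polynomials in `λ` and `μ`, is stated for all complex values `l`, `m` of `λ`, `μ`. -/
structure LieConformalSuperalgebra (S : Type*) [AddCommGroup S] [Module ℂ S] [Module ℂ[X] S]
    [IsScalarTower ℂ ℂ[X] S] where
  /-- the even part `part 0` and the odd part `part 1` -/
  part : ZMod 2 → Submodule ℂ[X] S
  isCompl_part : IsCompl (part 0) (part 1)
  /-- the `λ`-bracket -/
  bracket : S →ₗ[ℂ] S →ₗ[ℂ] LambdaPoly S
  bracket_mem : ∀ (α β : ZMod 2) (a b : S), a ∈ part α → b ∈ part β →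
    ∀ n, (bracket a b).coeff n ∈ part (α + β)
  /-- `[∂a_λ b] = -λ [a_λ b]` -/
  bracket_d_left : ∀ a b : S, bracket ((X : ℂ[X]) • a) b = -((X : ℂ[X][X]) • bracket a b)
  /-- `[a_λ ∂b] = (∂ + λ) [a_λ b]` -/
  bracket_d_right : ∀ a b : S, bracket a ((X : ℂ[X]) • b) = (C X + X : ℂ[X][X]) • bracket a b
  /-- `[a_λ b] = -(-1)^{|a||b|} [b_{-λ-∂} a]` -/
  skew : ∀ (α β : ZMod 2) (a b : S), a ∈ part α → b ∈ part β →
    bracket a b = -(paritySign α β • PolynomialModule.comp (-X - C X : ℂ[X][X]) (bracket b a))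
  /-- `[a_λ [b_μ c]] = [[a_λ b]_{λ+μ} c] + (-1)^{|a||b|} [b_μ [a_λ c]]` -/
  jacobi : ∀ (α β : ZMod 2) (a b c : S), a ∈ part α → b ∈ part β → ∀ l m : ℂ,
    LambdaPoly.evalAt l (bracket a (LambdaPoly.evalAt m (bracket b c))) =
      LambdaPoly.evalAt (l + m) (bracket (LambdaPoly.evalAt l (bracket a b)) c) +
        paritySign α β • LambdaPoly.evalAt m (bracket b (LambdaPoly.evalAt l (bracket a c)))

/-- The structure of a conformal module over the Lie conformal superalgebra `A` on a
`ℂ[∂]`-module `V`. -/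
structure ConformalModule {S : Type*} [AddCommGroup S] [Module ℂ S] [Module ℂ[X] S]
    [IsScalarTower ℂ ℂ[X] S] (A : LieConformalSuperalgebra S)
    (V : Type*) [AddCommGroup V] [Module ℂ V] [Module ℂ[X] V] [IsScalarTower ℂ ℂ[X] V] where
  /-- the even part `part 0` and the odd part `part 1` -/
  part : ZMod 2 → Submodule ℂ[X] V
  isCompl_part : IsCompl (part 0) (part 1)
  /-- the `λ`-action -/
  act : S →ₗ[ℂ] V →ₗ[ℂ] LambdaPoly V
  act_mem : ∀ (α β : ZMod 2) (a : S) (v : V), a ∈ A.part α → v ∈ part β →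
    ∀ n, (act a v).coeff n ∈ part (α + β)
  /-- `(∂a)_λ v = -λ a_λ v` -/
  act_d_left : ∀ (a : S) (v : V), act ((X : ℂ[X]) • a) v = -((X : ℂ[X][X]) • act a v)
  /-- `a_λ (∂v) = (∂ + λ) a_λ v` -/
  act_d_right : ∀ (a : S) (v : V), act a ((X : ℂ[X]) • v) = (C X + X : ℂ[X][X]) • act a v
  /-- `a_λ (b_μ v) - (-1)^{|a||b|} b_μ (a_λ v) = [a_λ b]_{λ+μ} v` -/
  act_bracket : ∀ (α β : ZMod 2) (a b : S) (v : V), a ∈ A.part α → b ∈ A.part β → ∀ l m : ℂ,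
    LambdaPoly.evalAt l (act a (LambdaPoly.evalAt m (act b v))) -
        paritySign α β • LambdaPoly.evalAt m (act b (LambdaPoly.evalAt l (act a v))) =
      LambdaPoly.evalAt (l + m) (act (LambdaPoly.evalAt l (A.bracket a b)) v)

/-- A conformal module is non-trivial if its `λ`-action is not identically zero. -/
def ConformalModule.Nontrivial {S : Type*} [AddCommGroup S] [Module ℂ S] [Module ℂ[X] S]
    [IsScalarTower ℂ ℂ[X] S] {A : LieConformalSuperalgebra S}
    {V : Type*} [AddCommGroup V] [Module ℂ V] [Module ℂ[X] V] [IsScalarTower ℂ ℂ[X] V]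
    (M : ConformalModule A V) : Prop :=
  ∃ (a : S) (v : V), M.act a v ≠ 0

/-! ### Ideals and quotients -/

section Projection

variable {S : Type*} [AddCommGroup S] [Module ℂ[X] S]

/-- The projection `S[λ] → (S/I)[λ]`. -/
def LambdaPoly.mk (I : Submodule ℂ[X] S) : LambdaPoly S →ₗ[ℂ[X]] LambdaPoly (S ⧸ I) :=
  PolynomialModule.map ℂ[X] I.mkQ

theorem LambdaPoly.coeff_mk (I : Submodule ℂ[X] S) (P : LambdaPoly S) (n : ℕ) :
    (LambdaPoly.mk I P).coeff n = I.mkQ (P.coeff n) := by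
  simp [LambdaPoly.mk, PolynomialModule.map]

theorem LambdaPoly.mk_eq_zero (I : Submodule ℂ[X] S) (P : LambdaPoly S)
    (h : ∀ n, P.coeff n ∈ I) : LambdaPoly.mk I P = 0 := by
  ext n
  rw [LambdaPoly.coeff_mk]
  simpa using h n

theorem LambdaPoly.mk_smul (I : Submodule ℂ[X] S) (q : ℂ[X][X]) (P : LambdaPoly S) :
    LambdaPoly.mk I (q • P) = q • LambdaPoly.mk I P := by
  have := PolynomialModule.map_smul (R' := ℂ[X]) I.mkQ q P
  simpa [LambdaPoly.mk] using this

theorem LambdaPoly.evalAt_mk (I : Submodule ℂ[X] S) (l : ℂ) (P : LambdaPoly S) :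
    LambdaPoly.evalAt l (LambdaPoly.mk I P) = I.mkQ (LambdaPoly.evalAt l P) :=
  PolynomialModule.eval_map (R' := ℂ[X]) I.mkQ P (C l)

theorem LambdaPoly.comp_mk (I : Submodule ℂ[X] S) (q : ℂ[X][X]) (P : LambdaPoly S) :
    PolynomialModule.comp q (LambdaPoly.mk I P) = LambdaPoly.mk I (PolynomialModule.comp q P) := by
  induction P using PolynomialModule.induction_linear with
  | zero => simp
  | add P Q hP hQ => simp only [map_add, hP, hQ]
  | single n m =>
    rw [PolynomialModule.comp_single, LambdaPoly.mk_smul]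
    simp only [LambdaPoly.mk, PolynomialModule.map_single, PolynomialModule.comp_single]

theorem LambdaPoly.mkQ_out (I : Submodule ℂ[X] S) (x : S ⧸ I) : I.mkQ (Quotient.out x) = x :=
  Quotient.out_eq x

end Projection

section Quotient

variable {S : Type*} [AddCommGroup S] [Module ℂ S] [Module ℂ[X] S] [IsScalarTower ℂ ℂ[X] S]

/-- A (graded, two-sided) ideal of a Lie conformal superalgebra. -/
structure LieConformalSuperalgebra.IsIdeal (A : LieConformalSuperalgebra S)
    (I : Submodule ℂ[X] S) : Prop where
  graded : I ≤ (I ⊓ A.part 0) ⊔ (I ⊓ A.part 1)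
  bracket_mem_right : ∀ (a : S), ∀ x ∈ I, ∀ n, (A.bracket a x).coeff n ∈ I
  bracket_mem_left : ∀ x ∈ I, ∀ (a : S), ∀ n, (A.bracket x a).coeff n ∈ I

theorem LieConformalSuperalgebra.IsIdeal.mk_bracket_congr {A : LieConformalSuperalgebra S}
    {I : Submodule ℂ[X] S} (h : A.IsIdeal I) {a a' b b' : S}
    (ha : I.mkQ a = I.mkQ a') (hb : I.mkQ b = I.mkQ b') :
    LambdaPoly.mk I (A.bracket a b) = LambdaPoly.mk I (A.bracket a' b') := by
  have ha' : a - a' ∈ I := by simpa [Submodule.Quotient.eq] using ha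
  have hb' : b - b' ∈ I := by simpa [Submodule.Quotient.eq] using hb
  have h1 := LambdaPoly.mk_eq_zero I _ (h.bracket_mem_left _ ha' b)
  have h2 := LambdaPoly.mk_eq_zero I _ (h.bracket_mem_right a' _ hb')
  simp only [map_sub, LinearMap.sub_apply, sub_eq_zero] at h1 h2
  rw [h1, h2]

/-- The bracket `[(a + I)_λ (b + I)] = [a_λ b] + I[λ]` on `S/I`. -/
def LieConformalSuperalgebra.IsIdeal.bracket {A : LieConformalSuperalgebra S}
    {I : Submodule ℂ[X] S} (h : A.IsIdeal I) :
    (S ⧸ I) →ₗ[ℂ] (S ⧸ I) →ₗ[ℂ] LambdaPoly (S ⧸ I) :=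
  LinearMap.mk₂ ℂ
    (fun x y => LambdaPoly.mk I (A.bracket (Quotient.out x) (Quotient.out y)))
    (fun x x' y => by
      rw [← map_add, ← LinearMap.add_apply, ← map_add]
      exact h.mk_bracket_congr (by simp only [map_add, LambdaPoly.mkQ_out]) rfl)
    (fun c x y => by
      rw [← LinearMap.map_smul_of_tower, ← LinearMap.smul_apply, ← map_smul]
      exact h.mk_bracket_congr
        (by simp only [LinearMap.map_smul_of_tower, LambdaPoly.mkQ_out]) rfl)
    (fun x y y' => by
      rw [← map_add, ← map_add]
      exact h.mk_bracket_congr rfl (by simp only [map_add, LambdaPoly.mkQ_out]))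
    (fun c x y => by
      rw [← LinearMap.map_smul_of_tower, ← map_smul]
      exact h.mk_bracket_congr rfl
        (by simp only [LinearMap.map_smul_of_tower, LambdaPoly.mkQ_out]))

theorem LieConformalSuperalgebra.IsIdeal.bracket_mk {A : LieConformalSuperalgebra S}
    {I : Submodule ℂ[X] S} (h : A.IsIdeal I) (a b : S) :
    h.bracket (I.mkQ a) (I.mkQ b) = LambdaPoly.mk I (A.bracket a b) :=
  h.mk_bracket_congr (LambdaPoly.mkQ_out I _) (LambdaPoly.mkQ_out I _)

/-- The quotient Lie conformal superalgebra `S/I`. -/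
def LieConformalSuperalgebra.quotient (A : LieConformalSuperalgebra S)
    (I : Submodule ℂ[X] S) (h : A.IsIdeal I) : LieConformalSuperalgebra (S ⧸ I) where
  part α := (A.part α).map I.mkQ
  isCompl_part := by
    constructor
    · rw [Submodule.disjoint_def]
      rintro _ ⟨a, ha, rfl⟩ ⟨b, hb, hab⟩
      have hI : b - a ∈ I := by simpa [Submodule.Quotient.eq] using hab
      obtain ⟨u, hu, w, hw, huw⟩ := Submodule.mem_sup.1 (h.graded hI)
      have h1 : u + a ∈ A.part 0 := Submodule.add_mem _ hu.2 ha
      have h2 : u + a ∈ A.part 1 := by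
        have : u + a = b - w := by rw [eq_sub_iff_add_eq, add_right_comm, huw]; abel
        rw [this]
        exact Submodule.sub_mem _ hb hw.2
      have h0 := Submodule.disjoint_def.1 A.isCompl_part.disjoint _ h1 h2
      have : a = -u := by rw [eq_neg_iff_add_eq_zero, add_comm]; exact h0
      rw [this]
      simpa using hu.1
    · rw [codisjoint_iff, ← Submodule.map_sup, A.isCompl_part.sup_eq_top, Submodule.map_top,
        Submodule.range_mkQ]
  bracket := h.bracket
  bracket_mem := by
    rintro α β _ _ ⟨a, ha, rfl⟩ ⟨b, hb, rfl⟩ n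
    rw [h.bracket_mk, LambdaPoly.coeff_mk]
    exact Submodule.mem_map_of_mem (A.bracket_mem α β a b ha hb n)
  bracket_d_left a b := by
    obtain ⟨a, rfl⟩ := I.mkQ_surjective a
    obtain ⟨b, rfl⟩ := I.mkQ_surjective b
    rw [← map_smul, h.bracket_mk, h.bracket_mk, A.bracket_d_left, map_neg, LambdaPoly.mk_smul]
  bracket_d_right a b := by
    obtain ⟨a, rfl⟩ := I.mkQ_surjective a
    obtain ⟨b, rfl⟩ := I.mkQ_surjective b
    rw [← map_smul, h.bracket_mk, h.bracket_mk, A.bracket_d_right, LambdaPoly.mk_smul]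
  skew := by
    rintro α β _ _ ⟨a, ha, rfl⟩ ⟨b, hb, rfl⟩
    rw [h.bracket_mk, h.bracket_mk, A.skew α β a b ha hb, LambdaPoly.comp_mk, map_neg,
      LinearMap.map_smul_of_tower]
  jacobi := by
    rintro α β _ _ c ⟨a, ha, rfl⟩ ⟨b, hb, rfl⟩ l m
    obtain ⟨c, rfl⟩ := I.mkQ_surjective c
    simp only [h.bracket_mk, LambdaPoly.evalAt_mk]
    rw [A.jacobi α β a b c ha hb, map_add, LinearMap.map_smul_of_tower]

end Quotient

/-! ### The Lie conformal superalgebra `𝒮(p)` -/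

namespace BlockS

/-- The free generators `L_i`, `W_i` (even) and `G_i` (odd), `i ∈ ℤ₊`. -/
inductive Gen : Type
  | L (i : ℕ) : Gen
  | W (i : ℕ) : Gen
  | G (i : ℕ) : Gen

namespace Gen

/-- the parity of a generator -/
def parity : Gen → ZMod 2
  | L _ => 0
  | W _ => 0
  | G _ => 1

/-- the index of a generator -/
def index : Gen → ℕ
  | L i => i
  | W i => i
  | G i => i

end Gen

/-- The underlying free `ℂ[∂]`-module of `𝒮(p)`, with basis `L_i`, `W_i`, `G_i`. -/
abbrev Carrier : Type := Gen →₀ ℂ[X]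

/-- A generator as an element of `𝒮(p)`. -/
def gen (x : Gen) : Carrier := Finsupp.single x 1

/-- the elements `L_i` -/
def L (i : ℕ) : Carrier := gen (Gen.L i)

/-- the elements `W_i` -/
def W (i : ℕ) : Carrier := gen (Gen.W i)

/-- the elements `G_i` -/
def G (i : ℕ) : Carrier := gen (Gen.G i)

/-- `(a ∂ + b λ) u` as an element of `𝒮(p)[λ]`. -/
def lin (a b : ℂ) (u : Carrier) : LambdaPoly Carrier :=
  (C (C a * X) + C (C b) * X : ℂ[X][X]) • PolynomialModule.single ℂ[X] 0 u

/-- The `λ`-brackets of the generators; those of `(W, L)`, `(G, L)`, `(G, W)` are the ones that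
skew-symmetry forces. -/
def genBracket (p : ℂ) : Gen → Gen → LambdaPoly Carrier
  | .L i, .L j => lin (i + p) (i + j + 2 * p) (L (i + j))
  | .L i, .W j => lin (i + p) (i + j + p) (W (i + j))
  | .L i, .G j => lin (i + p) (i + j + 2 * p) (G (i + j))
  | .W i, .L j => lin i (i + j + p) (W (i + j))
  | .W _, .W _ => 0
  | .W i, .G j => PolynomialModule.single ℂ[X] 0 (G (i + j))
  | .G i, .L j => lin (i + p) (i + j + 2 * p) (G (i + j))
  | .G i, .W j => -PolynomialModule.single ℂ[X] 0 (G (i + j))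
  | .G _, .G _ => 0

/-- The sesquilinear extension: `[f(∂)x _λ g(∂)y] = f(-λ) g(∂ + λ) [x _λ y]` for generators
`x`, `y`. -/
def bracket (p : ℂ) : Carrier →ₗ[ℂ] Carrier →ₗ[ℂ] LambdaPoly Carrier :=
  LinearMap.mk₂ ℂ
    (fun a b => a.sum fun x f => b.sum fun y g =>
      (aeval (-X : ℂ[X][X]) f * aeval (C X + X : ℂ[X][X]) g) • genBracket p x y)
    (fun a a' b => by
      refine Finsupp.sum_add_index' (by simp) fun x f f' => ?_
      simp only [map_add, add_mul, add_smul, Finsupp.sum_add])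
    (fun c a b => by
      rw [Finsupp.sum_smul_index' (by simp), Finsupp.smul_sum]
      refine Finsupp.sum_congr fun x _ => ?_
      rw [Finsupp.smul_sum]
      refine Finsupp.sum_congr fun y _ => ?_
      rw [map_smul, smul_mul_assoc, smul_assoc])
    (fun a b b' => by
      rw [← Finsupp.sum_add]
      refine Finsupp.sum_congr fun x _ => ?_
      refine Finsupp.sum_add_index' (by simp) fun y g g' => ?_
      simp only [map_add, mul_add, add_smul])
    (fun c a b => by
      rw [Finsupp.smul_sum]
      refine Finsupp.sum_congr fun x _ => ?_
      rw [Finsupp.sum_smul_index' (by simp), Finsupp.smul_sum]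
      refine Finsupp.sum_congr fun y _ => ?_
      rw [map_smul, mul_smul_comm, smul_assoc])

theorem bracket_single (p : ℂ) (x y : Gen) (f g : ℂ[X]) :
    bracket p (Finsupp.single x f) (Finsupp.single y g) =
      (aeval (-X : ℂ[X][X]) f * aeval (C X + X : ℂ[X][X]) g) • genBracket p x y := by
  simp [bracket]

theorem bracket_gen (p : ℂ) (x y : Gen) : bracket p (gen x) (gen y) = genBracket p x y := by
  simp [gen, bracket_single]

theorem bracket_smul_left (p : ℂ) (f : ℂ[X]) (a b : Carrier) :
    bracket p (f • a) b = aeval (-X : ℂ[X][X]) f • bracket p a b := by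
  simp only [bracket, LinearMap.mk₂_apply]
  rw [Finsupp.sum_smul_index' (by simp), Finsupp.smul_sum]
  refine Finsupp.sum_congr fun x _ => ?_
  rw [Finsupp.smul_sum]
  refine Finsupp.sum_congr fun y _ => ?_
  rw [smul_eq_mul, map_mul, mul_assoc, smul_smul]

theorem bracket_smul_right (p : ℂ) (f : ℂ[X]) (a b : Carrier) :
    bracket p a (f • b) = aeval (C X + X : ℂ[X][X]) f • bracket p a b := by
  simp only [bracket, LinearMap.mk₂_apply]
  rw [Finsupp.smul_sum]
  refine Finsupp.sum_congr fun x _ => ?_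
  rw [Finsupp.sum_smul_index' (by simp), Finsupp.smul_sum]
  refine Finsupp.sum_congr fun y _ => ?_
  rw [smul_eq_mul, map_mul, mul_left_comm, smul_smul]

theorem evalAt_smul (l : ℂ) (q : ℂ[X][X]) (P : LambdaPoly Carrier) :
    LambdaPoly.evalAt l (q • P) = q.eval (C l) • LambdaPoly.evalAt l P :=
  PolynomialModule.eval_smul q P (C l)

theorem eval_aeval_left (l : ℂ) (f : ℂ[X]) :
    (aeval (-X : ℂ[X][X]) f).eval (C l) = C (f.eval (-l)) := by
  induction f using Polynomial.induction_on' with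
  | add f g hf hg => simp only [map_add, eval_add, hf, hg]
  | monomial n c =>
    simp [aeval_monomial, IsScalarTower.algebraMap_apply ℂ ℂ[X] ℂ[X][X]]

theorem eval_aeval_right (l : ℂ) (f : ℂ[X]) :
    (aeval (C X + X : ℂ[X][X]) f).eval (C l) = f.comp (X + C l) := by
  induction f using Polynomial.induction_on' with
  | add f g hf hg => simp only [map_add, eval_add, hf, hg, add_comp]
  | monomial n c =>
    simp [aeval_monomial, IsScalarTower.algebraMap_apply ℂ ℂ[X] ℂ[X][X]]

theorem evalAt_bracket_smul_left (p l : ℂ) (f : ℂ[X]) (a b : Carrier) :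
    LambdaPoly.evalAt l (bracket p (f • a) b) =
      C (f.eval (-l)) • LambdaPoly.evalAt l (bracket p a b) := by
  rw [bracket_smul_left, evalAt_smul, eval_aeval_left]

theorem evalAt_bracket_smul_right (p l : ℂ) (f : ℂ[X]) (a b : Carrier) :
    LambdaPoly.evalAt l (bracket p a (f • b)) =
      f.comp (X + C l) • LambdaPoly.evalAt l (bracket p a b) := by
  rw [bracket_smul_right, evalAt_smul, eval_aeval_right]

theorem evalAt_lin (l a b : ℂ) (u : Carrier) :
    LambdaPoly.evalAt l (lin a b u) = (C a * X + C (b * l)) • u := by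
  rw [lin, evalAt_smul]
  simp [LambdaPoly.evalAt]

theorem evalAt_single (l : ℂ) (u : Carrier) :
    LambdaPoly.evalAt l (PolynomialModule.single ℂ[X] 0 u) = u := by
  simp [LambdaPoly.evalAt]

/-- The elements of parity `α`: the free `ℂ[∂]`-module on the generators of parity `α`. -/
def part (α : ZMod 2) : Submodule ℂ[X] Carrier :=
  Finsupp.supported ℂ[X] ℂ[X] {x | x.parity = α}

theorem part_induction {α : ZMod 2} {P : Carrier → Prop} {a : Carrier} (ha : a ∈ part α)
    (hgen : ∀ x : Gen, x.parity = α → P (gen x)) (hzero : P 0)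
    (hadd : ∀ a b, P a → P b → P (a + b)) (hsmul : ∀ (f : ℂ[X]) a, P a → P (f • a)) : P a := by
  rw [part, Finsupp.supported_eq_span_single] at ha
  induction ha using Submodule.span_induction with
  | mem _ h => obtain ⟨x, hx, rfl⟩ := h; exact hgen x hx
  | zero => exact hzero
  | add a b _ _ iha ihb => exact hadd a b iha ihb
  | smul f a _ ih => exact hsmul f a ih

theorem carrier_induction {P : Carrier → Prop} (a : Carrier)
    (hgen : ∀ x : Gen, P (gen x)) (hzero : P 0)
    (hadd : ∀ a b, P a → P b → P (a + b)) (hsmul : ∀ (f : ℂ[X]) a, P a → P (f • a)) : P a := by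
  induction a using Finsupp.induction_linear with
  | zero => exact hzero
  | add a b iha ihb => exact hadd a b iha ihb
  | single x f => simpa [gen] using hsmul f _ (hgen x)

theorem gen_mem_part (x : Gen) : gen x ∈ part x.parity :=
  Finsupp.single_mem_supported _ _ rfl

theorem isCompl_part : IsCompl (part 0) (part 1) := by
  constructor
  · refine Finsupp.disjoint_supported_supported ?_
    rw [Set.disjoint_left]
    intro x hx hx'
    have h0 : x.parity = 0 := hx
    have h1 : x.parity = 1 := hx'
    rw [h0] at h1
    exact absurd h1 (by decide)
  · refine Finsupp.codisjoint_supported_supported ?_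
    rw [codisjoint_iff]
    ext x
    cases x <;> simp [Gen.parity]

theorem coeff_smul_mem (N : Submodule ℂ[X] Carrier) (q : ℂ[X][X]) (P : LambdaPoly Carrier)
    (h : ∀ n, P.coeff n ∈ N) (n : ℕ) : (q • P).coeff n ∈ N := by
  rw [PolynomialModule.smul_apply]
  exact Submodule.sum_mem _ fun x _ => Submodule.smul_mem _ _ (h _)

theorem coeff_single_mem (N : Submodule ℂ[X] Carrier) (u : Carrier) (h : u ∈ N) (n : ℕ) :
    (PolynomialModule.single ℂ[X] 0 u).coeff n ∈ N := by
  rw [PolynomialModule.coeff_single, Finsupp.single_apply]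
  split_ifs
  · exact h
  · exact N.zero_mem

theorem coeff_lin_mem (N : Submodule ℂ[X] Carrier) (a b : ℂ) (u : Carrier) (h : u ∈ N) (n : ℕ) :
    (lin a b u).coeff n ∈ N :=
  coeff_smul_mem N _ _ (coeff_single_mem N u h) n

theorem coeff_genBracket_mem (p : ℂ) (N : Submodule ℂ[X] Carrier) (x y : Gen)
    (h : ∀ z : Gen, z.index = x.index + y.index → z.parity = x.parity + y.parity → gen z ∈ N)
    (n : ℕ) : (genBracket p x y).coeff n ∈ N := by
  cases x <;> cases y <;> simp only [genBracket]
  case L.L => exact coeff_lin_mem N _ _ _ (h _ rfl (by simp [Gen.parity])) n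
  case L.W => exact coeff_lin_mem N _ _ _ (h _ rfl (by simp [Gen.parity])) n
  case L.G => exact coeff_lin_mem N _ _ _ (h _ rfl (by simp [Gen.parity])) n
  case W.L => exact coeff_lin_mem N _ _ _ (h _ rfl (by simp [Gen.parity])) n
  case W.W => exact N.zero_mem
  case W.G => exact coeff_single_mem N _ (h _ rfl (by simp [Gen.parity])) n
  case G.L => exact coeff_lin_mem N _ _ _ (h _ rfl (by simp [Gen.parity])) n
  case G.W =>
    rw [← neg_one_smul ℂ[X][X]]
    exact coeff_smul_mem N _ _ (coeff_single_mem N _ (h _ rfl (by simp [Gen.parity]))) n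
  case G.G => exact N.zero_mem

theorem bracket_coeff_mem (p : ℂ) (A B N : Set Gen)
    (h : ∀ x ∈ A, ∀ y ∈ B, ∀ z : Gen, z.index = x.index + y.index →
      z.parity = x.parity + y.parity → z ∈ N)
    (a b : Carrier) (ha : a ∈ Finsupp.supported ℂ[X] ℂ[X] A)
    (hb : b ∈ Finsupp.supported ℂ[X] ℂ[X] B) (n : ℕ) :
    (bracket p a b).coeff n ∈ Finsupp.supported ℂ[X] ℂ[X] N := by
  simp only [bracket, LinearMap.mk₂_apply, Finsupp.sum, PolynomialModule.coeff_sum,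
    Finsupp.finsetSum_apply]
  refine Submodule.sum_mem _ fun x hx => Submodule.sum_mem _ fun y hy => ?_
  refine coeff_smul_mem _ _ _ (fun m => coeff_genBracket_mem p _ x y ?_ m) n
  intro z hz hz'
  exact Finsupp.single_mem_supported _ _ (h x (ha hx) y (hb hy) z hz hz')

theorem bracket_skew (p : ℂ) (α β : ZMod 2) (a b : Carrier) (ha : a ∈ part α) (hb : b ∈ part β) :
    bracket p a b =
      -(paritySign α β • PolynomialModule.comp (-X - C X : ℂ[X][X]) (bracket p b a)) := by
  have hL : ∀ f : ℂ[X], (aeval (-X : ℂ[X][X]) f).comp (-X - C X) = aeval (C X + X : ℂ[X][X]) f := by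
    intro f
    induction f using Polynomial.induction_on' with
    | add f g hf hg => simp only [map_add, add_comp, hf, hg]
    | monomial n c =>
      simp [aeval_monomial, IsScalarTower.algebraMap_apply ℂ ℂ[X] ℂ[X][X], add_comm]
  have hR : ∀ f : ℂ[X], (aeval (C X + X : ℂ[X][X]) f).comp (-X - C X) = aeval (-X : ℂ[X][X]) f := by
    intro f
    induction f using Polynomial.induction_on' with
    | add f g hf hg => simp only [map_add, add_comp, hf, hg]
    | monomial n c =>
      simp [aeval_monomial, IsScalarTower.algebraMap_apply ℂ ℂ[X] ℂ[X][X]]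
  refine part_induction (P := fun a => bracket p a b = -(paritySign α β •
    PolynomialModule.comp (-X - C X : ℂ[X][X]) (bracket p b a)))
    ha (fun x hx => ?_) ?_ (fun a a' h h' => ?_) (fun f a h => ?_)
  · refine part_induction (P := fun b => bracket p (gen x) b = -(paritySign α β •
      PolynomialModule.comp (-X - C X : ℂ[X][X]) (bracket p b (gen x))))
      hb (fun y hy => ?_) ?_ (fun b b' h h' => ?_) (fun f b h => ?_)
    · subst hx hy
      rw [bracket_gen, bracket_gen]
      cases x <;> cases y <;>
        simp only [genBracket, Gen.parity, paritySign, lin, PolynomialModule.comp_smul,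
          PolynomialModule.comp_single, map_neg, map_zero, neg_zero, smul_zero, pow_zero, one_smul,
          ZMod.val_zero, mul_zero, zero_mul, neg_neg, ← neg_smul]
      case L.W | W.L | L.L | L.G | G.L =>
        rename_i i j
        rw [add_comm j i]
        congr 1
        simp only [add_comp, mul_comp, C_comp, X_comp, map_add, map_mul, map_natCast,
          natCast_comp, map_ofNat, ofNat_comp]
        ring
      case W.G | G.W => rw [Nat.add_comm]
    · simp
    · simp only [map_add, LinearMap.add_apply, smul_add, neg_add, ← h, ← h']
    · rw [bracket_smul_right, bracket_smul_left, PolynomialModule.comp_smul, hL, h, smul_neg,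
        smul_comm]
  · simp
  · simp only [map_add, LinearMap.add_apply, smul_add, neg_add, ← h, ← h']
  · rw [bracket_smul_right, bracket_smul_left, PolynomialModule.comp_smul, hR, h, smul_neg,
      smul_comm]

theorem evalAt_C_smul_left (p l c : ℂ) (a b : Carrier) :
    LambdaPoly.evalAt l (bracket p (C c • a) b) = C c • LambdaPoly.evalAt l (bracket p a b) := by
  rw [evalAt_bracket_smul_left, eval_C]

/-- The Jacobi identity for `a`, `b`, `c` with sign `s`, at `λ = l`, `μ = m`. -/
def JacobiAt (p s l m : ℂ) (a b c : Carrier) : Prop :=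
  LambdaPoly.evalAt l (bracket p a (LambdaPoly.evalAt m (bracket p b c))) =
    LambdaPoly.evalAt (l + m) (bracket p (LambdaPoly.evalAt l (bracket p a b)) c) +
      s • LambdaPoly.evalAt m (bracket p b (LambdaPoly.evalAt l (bracket p a c)))

theorem jacobiAt_smul_left (p s l m : ℂ) (f : ℂ[X]) (a b c : Carrier)
    (H : JacobiAt p s l m a b c) : JacobiAt p s l m (f • a) b c := by
  unfold JacobiAt at *
  simp only [evalAt_bracket_smul_left, evalAt_bracket_smul_right, H, smul_add, eval_C, C_comp]
  rw [smul_comm s]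

theorem jacobiAt_smul_mid (p s l m : ℂ) (f : ℂ[X]) (a b c : Carrier)
    (H : JacobiAt p s l m a b c) : JacobiAt p s l m a (f • b) c := by
  unfold JacobiAt at *
  have : (f.comp (X + C l)).eval (-(l + m)) = f.eval (-m) := by
    rw [eval_comp, eval_add, eval_X, eval_C]; ring_nf
  rw [evalAt_bracket_smul_left, evalAt_bracket_smul_right, evalAt_bracket_smul_right,
    evalAt_bracket_smul_left, evalAt_bracket_smul_left, this, C_comp, H, smul_add, smul_comm s]

theorem jacobiAt_smul_right (p s l m : ℂ) (f : ℂ[X]) (a b c : Carrier)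
    (H : JacobiAt p s l m a b c) : JacobiAt p s l m a b (f • c) := by
  unfold JacobiAt at *
  have h1 : (f.comp (X + C m)).comp (X + C l) = f.comp (X + C (l + m)) := by
    rw [comp_assoc, add_comp, X_comp, C_comp, C_add, add_assoc]
  have h2 : (f.comp (X + C l)).comp (X + C m) = f.comp (X + C (l + m)) := by
    rw [comp_assoc, add_comp, X_comp, C_comp, C_add, add_assoc, add_comm (C m)]
  simp only [evalAt_bracket_smul_right, h1, h2, H, smul_add]
  rw [smul_comm s]

theorem jacobiAt_gen (p l m : ℂ) (x y z : Gen) :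
    JacobiAt p (paritySign x.parity y.parity) l m (gen x) (gen y) (gen z) := by
  unfold JacobiAt
  cases x <;> cases y <;> cases z <;>
    simp only [bracket_gen, genBracket, evalAt_lin, evalAt_single, map_zero, map_neg,
      evalAt_bracket_smul_left, evalAt_bracket_smul_right, L, W, G,
      Gen.parity, paritySign, LinearMap.zero_apply, LinearMap.neg_apply]
  all_goals
    simp only [ZMod.val_zero, mul_zero, zero_mul, pow_zero, one_smul, smul_zero, add_zero,
      neg_zero, Nat.add_assoc, Nat.add_left_comm, Nat.cast_add, add_comp, mul_comp, C_comp, X_comp,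
      eval_add, eval_mul, eval_C, eval_X, map_add, map_mul, map_neg, map_ofNat,
      ofNat_comp, eval_ofNat]
  all_goals module

theorem bracket_jacobi (p : ℂ) (α β : ZMod 2) (a b c : Carrier)
    (ha : a ∈ part α) (hb : b ∈ part β) (l m : ℂ) : JacobiAt p (paritySign α β) l m a b c := by
  refine part_induction (P := fun a => JacobiAt p (paritySign α β) l m a b c) ha
    (fun x hx => ?_) ?_ (fun a a' h h' => ?_) (fun f a h => ?_)
  · refine part_induction (P := fun b => JacobiAt p (paritySign α β) l m (gen x) b c) hb
      (fun y hy => ?_) ?_ (fun b b' h h' => ?_) (fun f b h => ?_)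
    · refine carrier_induction
        (P := fun c => JacobiAt p (paritySign α β) l m (gen x) (gen y) c) c
        (fun z => ?_) ?_ (fun c c' h h' => ?_) (fun f c h => ?_)
      · subst hx hy
        exact jacobiAt_gen p l m x y z
      · simp [JacobiAt]
      · unfold JacobiAt at *
        simp only [map_add, h, h', smul_add]; abel
      · exact jacobiAt_smul_right p _ l m f _ _ _ h
    · simp [JacobiAt]
    · unfold JacobiAt at *
      simp only [map_add, LinearMap.add_apply, h, h', smul_add]; abel
    · exact jacobiAt_smul_mid p _ l m f _ _ _ h
  · simp [JacobiAt]
  · unfold JacobiAt at *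
    simp only [map_add, LinearMap.add_apply, h, h', smul_add]; abel
  · exact jacobiAt_smul_left p _ l m f _ _ _ h

/-- The Lie conformal superalgebra `𝒮(p)`. -/
def algebra (p : ℂ) : LieConformalSuperalgebra Carrier where
  part := part
  isCompl_part := isCompl_part
  bracket := bracket p
  bracket_mem α β a b ha hb n := by
    refine bracket_coeff_mem p _ _ _ ?_ a b ha hb n
    rintro x rfl y rfl z _ hz
    exact hz
  bracket_d_left a b := by rw [bracket_smul_left, aeval_X, neg_smul]
  bracket_d_right a b := by rw [bracket_smul_right, aeval_X]
  skew := bracket_skew p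
  jacobi α β a b c ha hb l m := bracket_jacobi p α β a b c ha hb l m

/-- `𝒮(p)_{⟨n⟩} = ⨁_{i ≥ n} (ℂ[∂]L_i ⊕ ℂ[∂]W_i ⊕ ℂ[∂]G_i)`. -/
def tail (n : ℕ) : Submodule ℂ[X] Carrier :=
  Finsupp.supported ℂ[X] ℂ[X] {x | n ≤ x.index}

theorem isIdeal_tail (p : ℂ) (n : ℕ) : (algebra p).IsIdeal (tail n) where
  graded := by
    change tail n ≤ (tail n ⊓ part 0) ⊔ (tail n ⊓ part 1)
    rw [tail, Finsupp.supported_eq_span_single, Submodule.span_le,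
      ← Finsupp.supported_eq_span_single]
    rintro _ ⟨x, hx, rfl⟩
    have h1 : Finsupp.single x (1 : ℂ[X]) ∈ Finsupp.supported ℂ[X] ℂ[X] {x : Gen | n ≤ x.index} :=
      Finsupp.single_mem_supported _ _ hx
    have h2 := gen_mem_part x
    cases x
    · exact Submodule.mem_sup_left ⟨h1, h2⟩
    · exact Submodule.mem_sup_left ⟨h1, h2⟩
    · exact Submodule.mem_sup_right ⟨h1, h2⟩
  bracket_mem_right a x hx k := by
    refine bracket_coeff_mem p Set.univ {x | n ≤ x.index} _ ?_ a x (by simp) hx k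
    intro x _ y hy z hz _
    have hy' : n ≤ y.index := hy
    change n ≤ z.index
    lia
  bracket_mem_left x hx a k := by
    refine bracket_coeff_mem p {x | n ≤ x.index} Set.univ _ ?_ x a hx (by simp) k
    intro x hx y _ z hz _
    have hx' : n ≤ x.index := hx
    change n ≤ z.index
    lia

/-- The underlying `ℂ[∂]`-module of `𝒮(p)_{[n]} = 𝒮(p) / 𝒮(p)_{⟨n+1⟩}`. -/
abbrev QuotientCarrier (n : ℕ) : Type := Carrier ⧸ tail (n + 1)

/-- The quotient Lie conformal superalgebra `𝒮(p)_{[n]} = 𝒮(p) / 𝒮(p)_{⟨n+1⟩}`. -/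
def quotientAlgebra (p : ℂ) (n : ℕ) : LieConformalSuperalgebra (QuotientCarrier n) :=
  (algebra p).quotient (tail (n + 1)) (isIdeal_tail p (n + 1))

end BlockS

end

/-! The element `e = p⁻¹ L_0` generates a Virasoro conformal algebra, and each of `L_i`, `W_i`,
`G_i` is primary with respect to `e`, of a weight that is an injective function of `i`. So it
suffices that a primary element `b` acts by zero on `V` for all but finitely many values of its
weight.

As a module over the Virasoro algebra, the finite module `V` has a finite filtration whose
quotients are cyclic over `ℂ[∂]`, generated by a `u` with `e_λ u = 0` or with
`e_λ u = (∂ + α + Δ λ) u`: modulo the trivial part, the vectors `u` for which `e_λ u` has degree at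
most one in `λ` form a finite-dimensional space, on which the coefficients of `e_λ` have a common
eigenvector. If `b_λ` sends a generator `u` of one such quotient into another one, then comparing
the commutators with the coefficients of `λ`, `λ²` and `λ³` in `e_λ` gives a polynomial identity in
the weight of `b` and in the degree of `b_λ u`, which has only finitely many exceptional weights
unless `b_λ u = 0`. -/

section LinearAlgebra

variable {k : Type*} [Field k] {E : Type*} [AddCommGroup E] [Module k E]

theorem commutator_pow_eq_smul {f g : Module.End k E} {c : k} (h : f * g - g * f = c • g) (m : ℕ) :
    f * g ^ m - g ^ m * f = (m * c) • g ^ m := by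
  induction m with
  | zero => simp
  | succ m ih =>
    have leibniz : f * (g ^ m * g) - g ^ m * g * f =
        (f * g ^ m - g ^ m * f) * g + g ^ m * (f * g - g * f) := by
      noncomm_ring
    rw [pow_succ, leibniz, ih, h, smul_mul_assoc, mul_smul_comm, ← add_smul]
    push_cast
    ring_nf

/-- Otherwise `ad f` would have the infinitely many eigenvalues `m * c`. -/
theorem isNilpotent_of_commutator_eq_smul [CharZero k] [FiniteDimensional k E]
    {f g : Module.End k E} {c : k} (hc : c ≠ 0) (h : f * g - g * f = c • g) : IsNilpotent g := by
  by_contra hg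
  let ad : Module.End k (Module.End k E) := LinearMap.mulLeft k f - LinearMap.mulRight k f
  have eigenvalue (m : ℕ) : ad.HasEigenvalue (m * c) :=
    Module.End.hasEigenvalue_of_hasEigenvector (x := g ^ m)
      ⟨Module.End.mem_eigenspace_iff.2 (commutator_pow_eq_smul h m), fun h0 => hg ⟨m, h0⟩⟩
  have injective : Function.Injective fun m : ℕ => (m : k) * c := fun m n hmn => by
    simpa [hc] using hmn
  exact Set.infinite_of_injective_forall_mem injective eigenvalue
    (Module.End.finite_hasEigenvalue _)

theorem exists_common_eigenvector [IsAlgClosed k] [FiniteDimensional k E] [Nontrivial E]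
    {f g : Module.End k E} (h : Commute f g) :
    ∃ v ≠ 0, ∃ a b : k, f v = a • v ∧ g v = b • v := by
  obtain ⟨a, ha⟩ := Module.End.exists_eigenvalue f
  have : Nontrivial (f.eigenspace a) := Submodule.nontrivial_iff_ne_bot.2 ha
  have maps : Set.MapsTo g (f.eigenspace a) (f.eigenspace a) :=
    Module.End.mapsTo_genEigenspace_of_comm h a 1
  obtain ⟨b, hb⟩ := Module.End.exists_eigenvalue (g.restrict maps)
  obtain ⟨⟨v, hv⟩, hvb, hv0⟩ := hb.exists_hasEigenvector
  refine ⟨v, fun h0 => hv0 (Subtype.ext h0), a, b, Module.End.mem_eigenspace_iff.1 hv, ?_⟩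
  exact congrArg Subtype.val (Module.End.mem_eigenspace_iff.1 hvb)

theorem exists_mem_span_singleton_of_mem_span_eigenvectors {ι : Type*} {f : Module.End k E}
    {μ : ι → k} (hμ : Function.Injective μ) {y : ι → E} (hy : ∀ i, f.HasEigenvector (μ i) (y i))
    {v : E} (hv : v ∈ Submodule.span k (Set.range y)) (hv0 : v ≠ 0) {ν : k} (hν : f v = ν • v) :
    ∃ i, ν = μ i ∧ v ∈ Submodule.span k {y i} := by
  classical
  obtain ⟨c, rfl⟩ := (Finsupp.mem_span_range_iff_exists_finsupp).1 hv
  have independent := Module.End.eigenvectors_linearIndependent' f μ hμ y hy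
  have eigen (i : ι) : (ν - μ i) * c i = 0 := by
    have zero : ∑ i ∈ c.support, ((ν - μ i) * c i) • y i = 0 := by
      simp only [Finsupp.sum, map_sum, map_smul, (hy _).apply_eq_smul, Finset.smul_sum] at hν
      simp only [sub_mul, sub_smul, Finset.sum_sub_distrib, mul_smul, ← hν]
      simp only [smul_comm (c _), sub_self]
    by_cases hi : i ∈ c.support
    · exact linearIndependent_iff'.1 independent _ _ zero i hi
    · rw [Finsupp.notMem_support_iff.1 hi, mul_zero]
  obtain ⟨i, hi⟩ : ∃ i, c i ≠ 0 := by
    by_contra! h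
    exact hv0 (by simp [Finsupp.sum, h])
  have hνi : ν = μ i := sub_eq_zero.1 ((mul_eq_zero.1 (eigen i)).resolve_right hi)
  refine ⟨i, hνi, Submodule.sum_mem _ fun j _ => ?_⟩
  rcases mul_eq_zero.1 (eigen j) with hj | hj
  · rw [hμ ((sub_eq_zero.1 hj).symm.trans hνi)]
    exact Submodule.smul_mem _ _ (Submodule.mem_span_singleton_self _)
  · simp [hj]

theorem eventually_quadratic_ne_zero {a : k} (ha : a ≠ 0) (b c : k) :
    ∀ᶠ q in Filter.cofinite, a * q ^ 2 + b * q + c ≠ 0 := by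
  have hP : C a * X ^ 2 + C b * X + C c ≠ 0 := ne_zero_of_natDegree_gt
    ((natDegree_quadratic ha).symm ▸ Nat.zero_lt_two)
  refine (finite_setOfPred_isRoot hP).subset fun q hq => ?_
  simpa [IsRoot] using hq

end LinearAlgebra

section PolynomialModules

variable {k : Type*} [Field k] {W : Type*} [AddCommGroup W] [Module k W] [Module k[X] W]
  [IsScalarTower k k[X] W]

theorem C_smul_eq (c : k) (v : W) : (C c : k[X]) • v = c • v := by
  rw [← algebraMap_eq, algebraMap_smul]

theorem mem_span_X_add_C_pow_smul (c : k) {u v : W} (hv : v ∈ Submodule.span k[X] {u}) :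
    v ∈ Submodule.span k (Set.range fun n : ℕ => (X + C c : k[X]) ^ n • u) := by
  obtain ⟨f, rfl⟩ := Submodule.mem_span_singleton.1 hv
  rw [← sum_taylor_eq f (-c), Polynomial.sum, Finset.sum_smul]
  refine Submodule.sum_mem _ fun n _ => ?_
  rw [mul_smul, C_smul_eq, C_neg, sub_neg_eq_add]
  exact Submodule.smul_mem _ _ (Submodule.subset_span ⟨n, rfl⟩)

theorem finite_quotient_span_smul_top [Module.Finite k[X] W] {f : k[X]} (hf : f.Monic) :
    Module.Finite k (W ⧸ (Ideal.span {f} • ⊤ : Submodule k[X] W)) := by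
  have := hf.finite_quotient
  exact Module.Finite.trans (k[X] ⧸ Ideal.span {f}) _

theorem finiteDimensional_of_disjoint_smul_top [Module.Finite k[X] W] {f : k[X]} (hf : f.Monic)
    {K : Submodule k W} (hK : ∀ w : W, f • w ∈ K → f • w = 0) : FiniteDimensional k K := by
  have := finite_quotient_span_smul_top (W := W) hf
  let proj := (Ideal.span {f} • ⊤ : Submodule k[X] W).mkQ.restrictScalars k ∘ₗ K.subtype
  refine FiniteDimensional.of_injective proj ((injective_iff_map_eq_zero _).2 fun v hv => ?_)
  have mem : (v : W) ∈ (Ideal.span {f} • ⊤ : Submodule k[X] W) :=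
    (Submodule.Quotient.mk_eq_zero _).1 hv
  rw [Submodule.ideal_span_singleton_smul, Submodule.mem_smul_pointwise_iff_exists] at mem
  obtain ⟨w, -, hw⟩ := mem
  exact Subtype.ext (hw.symm.trans (hK w (hw.symm ▸ v.2)))

end PolynomialModules

theorem finite_finsupp_quotient_supported {ι R : Type*} [CommRing R] {s : Set ι}
    (hs : sᶜ.Finite) : Module.Finite R ((ι →₀ R) ⧸ Finsupp.supported R R s) := by
  have := hs.fintype
  have isCompl : IsCompl (Finsupp.supported R R s) (Finsupp.supported R R sᶜ) :=
    ⟨Finsupp.disjoint_supported_supported disjoint_compl_right,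
      Finsupp.codisjoint_supported_supported isCompl_compl.codisjoint⟩
  exact Module.Finite.equiv ((Submodule.quotientEquivOfIsCompl _ _ isCompl).trans
    (Finsupp.supportedEquivFinsupp sᶜ)).symm

section ConformalMaps

variable {k : Type*} [Field k] {V W : Type*} [AddCommGroup V] [Module k V] [AddCommGroup W]
  [Module k W]

/-- The vectors annihilated by the `φ a` with `a ≥ n`: `φ_λ v` has degree less than `n`. -/
def lowDegree (φ : ℕ → V →ₗ[k] W) (n : ℕ) : Submodule k V := ⨅ a ≥ n, LinearMap.ker (φ a)

/-- `φ_λ v` has degree exactly `n`. -/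
def HasDegree (φ : ℕ → V →ₗ[k] W) (n : ℕ) (v : V) : Prop := φ n v ≠ 0 ∧ ∀ a > n, φ a v = 0

theorem mem_lowDegree {φ : ℕ → V →ₗ[k] W} {n : ℕ} {v : V} :
    v ∈ lowDegree φ n ↔ ∀ a ≥ n, φ a v = 0 := by
  simp only [lowDegree, Submodule.mem_iInf, LinearMap.mem_ker]

theorem lowDegree_mono (φ : ℕ → V →ₗ[k] W) : Monotone (lowDegree φ) := fun _ _ hmn _ hv =>
  mem_lowDegree.2 fun a ha => mem_lowDegree.1 hv a (hmn.trans ha)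

variable [Module k[X] V] [Module k[X] W]

/-- A conformal linear map `φ_λ : V → W[λ]`, that is, `φ_λ (∂v) = (∂ + λ) (φ_λ v)`, encoded by the
maps `φ n` for which `φ_λ = ∑ n, φ n * λⁿ / n!`. -/
structure IsConformalLinearMap (φ : ℕ → V →ₗ[k] W) : Prop where
  X_smul (n : ℕ) (v : V) : φ n ((X : k[X]) • v) = (X : k[X]) • φ n v + (n : k) • φ (n - 1) v
  locallyFinite (v : V) : ∃ N, ∀ n ≥ N, φ n v = 0

namespace IsConformalLinearMap

variable {φ : ℕ → V →ₗ[k] W} (hφ : IsConformalLinearMap φ)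
include hφ

theorem exists_hasDegree {v : V} (hv : ∃ n, φ n v ≠ 0) : ∃ n, HasDegree φ n v := by
  obtain ⟨N, hN⟩ := hφ.locallyFinite v
  have bounded : BddAbove {n | φ n v ≠ 0} := ⟨N, fun n hn => by
    by_contra! h
    exact hn (hN n h.le)⟩
  exact ⟨_, Nat.sSup_mem hv bounded, fun a ha => by
    by_contra h
    exact (le_csSup bounded h).not_gt ha⟩

variable [IsScalarTower k k[X] V] [IsScalarTower k k[X] W]

theorem X_add_C_smul (c : k) (n : ℕ) (v : V) :
    φ n ((X + C c : k[X]) • v) = (X + C c : k[X]) • φ n v + (n : k) • φ (n - 1) v := by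
  rw [add_smul, map_add, hφ.X_smul, C_smul_eq, map_smul, add_smul, C_smul_eq]
  abel

theorem hasDegree_X_add_C_pow_smul [CharZero k] {N : ℕ} {v : V} (hv : HasDegree φ N v) (c : k)
    (n : ℕ) : HasDegree φ (N + n) ((X + C c : k[X]) ^ n • v) := by
  induction n with
  | zero => simpa using hv
  | succ n ih =>
    rw [pow_succ', mul_smul, ← add_assoc]
    refine ⟨?_, fun a ha => ?_⟩
    · rw [hφ.X_add_C_smul, ih.2 _ (Nat.lt_succ_self _), smul_zero, zero_add, Nat.add_sub_cancel]
      exact smul_ne_zero (Nat.cast_ne_zero.2 (Nat.succ_ne_zero _)) ih.1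
    · rw [hφ.X_add_C_smul, ih.2 a (by lia), ih.2 (a - 1) (by lia), smul_zero, smul_zero, add_zero]

theorem finiteDimensional_lowDegree [CharZero k] [Module.Finite k[X] V]
    (faithful : lowDegree φ 0 = ⊥) (n : ℕ) : FiniteDimensional k (lowDegree φ n) := by
  refine finiteDimensional_of_disjoint_smul_top ((monic_X_add_C (0 : k)).pow n) fun v hv => ?_
  by_contra h
  have hv0 : ∃ a, φ a v ≠ 0 := by
    by_contra! h0
    have : v ∈ lowDegree φ 0 := mem_lowDegree.2 fun a _ => h0 a
    rw [faithful, Submodule.mem_bot] at this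
    exact h (by rw [this, smul_zero])
  obtain ⟨N, hN⟩ := hφ.exists_hasDegree hv0
  exact (hφ.hasDegree_X_add_C_pow_smul hN 0 n).1 (mem_lowDegree.1 hv _ (Nat.le_add_left n N))

/-- The `k[∂]`-submodule of the `v` with `φ_λ v ∈ J[λ]`. -/
def comap (J : Submodule k[X] W) : Submodule k[X] V where
  carrier := {v | ∀ n, φ n v ∈ J}
  add_mem' hv hw n := by
    rw [map_add]
    exact J.add_mem (hv n) (hw n)
  zero_mem' n := by
    rw [map_zero]
    exact J.zero_mem
  smul_mem' f v hv := by
    have smul_mem {c : k} {w : W} (hw : w ∈ J) : c • w ∈ J := by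
      rw [← C_smul_eq]
      exact J.smul_mem _ hw
    induction f using Polynomial.induction_on with
    | C c =>
      intro n
      rw [C_smul_eq, map_smul]
      exact smul_mem (hv n)
    | add f g hf hg =>
      intro n
      rw [add_smul, map_add]
      exact J.add_mem (hf n) (hg n)
    | monomial m c ih =>
      intro n
      rw [pow_succ', ← mul_assoc, mul_comm (C c) X, mul_assoc, mul_smul, hφ.X_smul]
      exact J.add_mem (J.smul_mem _ (ih n)) (smul_mem (ih (n - 1)))

end IsConformalLinearMap

end ConformalMaps

section VirasoroActions

/-- A conformal module over the Virasoro conformal algebra, `[L_λ L] = (∂ + 2λ) L`, with underlying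
`k[∂]`-module `W`; the action is `L_λ = ∑ n, op n * λⁿ / n!`. -/
structure VirasoroAction (k W : Type*) [Field k] [AddCommGroup W] [Module k W] [Module k[X] W] where
  op : ℕ → Module.End k W
  isConformal : IsConformalLinearMap op
  op_comm (a b : ℕ) (v : W) :
    op a (op b v) - op b (op a v) = ((a : k) - b) • op (a + b - 1) v

namespace VirasoroAction

variable {k W : Type*} [Field k] [AddCommGroup W] [Module k W] [Module k[X] W]
  (D : VirasoroAction k W)

theorem op_mem_lowDegree {b n : ℕ} (hb : 1 ≤ b) {v : W} (hv : v ∈ lowDegree D.op n) :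
    D.op b v ∈ lowDegree D.op n := mem_lowDegree.2 fun a ha => by
  have h := D.op_comm a b v
  rwa [mem_lowDegree.1 hv a ha, map_zero, sub_zero, mem_lowDegree.1 hv (a + b - 1) (by lia),
    smul_zero] at h

/-- A primary vector of weight `Δ`: a vector `u` such that `L_λ u` is `Δ λ u` up to a constant
term. -/
structure IsPrimary (Δ : k) (u : W) : Prop where
  one : D.op 1 u = Δ • u
  two_le (a : ℕ) (ha : 2 ≤ a) : D.op a u = 0

/-- A generator of the tensor density module `M(α, Δ)`: `L_λ u = (∂ + α + Δ λ) u`. -/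
structure IsDensity (α Δ : k) (u : W) : Prop extends D.IsPrimary Δ u where
  zero : D.op 0 u = (X + C α : k[X]) • u

theorem exists_lowDegree_ne_bot [Nontrivial W] : ∃ n, lowDegree D.op n ≠ ⊥ := by
  obtain ⟨v, hv⟩ := exists_ne (0 : W)
  obtain ⟨N, hN⟩ := D.isConformal.locallyFinite v
  exact ⟨N, (Submodule.ne_bot_iff _).2 ⟨v, mem_lowDegree.2 hN, hv⟩⟩

variable [IsScalarTower k k[X] W]

/-- The submodule of the vectors `u` with `L_λ u = 0`. -/
noncomputable def trivialPart : Submodule k[X] W := D.isConformal.comap ⊥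

variable {D} in
theorem mem_trivialPart {u : W} : u ∈ D.trivialPart ↔ ∀ a, D.op a u = 0 := Iff.rfl

variable {D} in
theorem isPrimary_of_mem_trivialPart {u : W} (hu : u ∈ D.trivialPart) : D.IsPrimary 0 u where
  one := by rw [mem_trivialPart.1 hu, zero_smul]
  two_le a _ := mem_trivialPart.1 hu a

/-- If `n` is least with `lowDegree n ≠ ⊥`, then `op (n - 1)` is injective on `lowDegree n`; it
would be nilpotent there if `n` were at least `3`, since `[op 1, op (n - 1)] = (2 - n) op (n - 1)`.
-/
theorem lowDegree_two_ne_bot [CharZero k] [Module.Finite k[X] W] [Nontrivial W]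
    (faithful : lowDegree D.op 0 = ⊥) : lowDegree D.op 2 ≠ ⊥ := by
  classical
  let n := Nat.find D.exists_lowDegree_ne_bot
  have hn : lowDegree D.op n ≠ ⊥ := Nat.find_spec D.exists_lowDegree_ne_bot
  have minimal : ∀ m < n, lowDegree D.op m = ⊥ := fun m hm =>
    not_not.1 (Nat.find_min D.exists_lowDegree_ne_bot hm)
  rcases le_or_gt n 2 with h2 | h2
  · exact ne_bot_of_le_ne_bot hn (lowDegree_mono D.op h2)
  exfalso
  have := D.isConformal.finiteDimensional_lowDegree faithful n
  have := Submodule.nontrivial_iff_ne_bot.2 hn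
  let restricted (b : ℕ) (hb : 1 ≤ b) : Module.End k (lowDegree D.op n) :=
    (D.op b).restrict fun v hv => D.op_mem_lowDegree hb hv
  let f := restricted 1 le_rfl
  let g := restricted (n - 1) (by lia)
  have injective : Function.Injective g := (injective_iff_map_eq_zero g).2 fun v hv => by
    have mem : (v : W) ∈ lowDegree D.op (n - 1) := mem_lowDegree.2 fun a ha => by
      rcases ha.eq_or_lt with rfl | ha
      · exact congrArg Subtype.val hv
      · exact mem_lowDegree.1 v.2 a (by lia)
    rw [minimal (n - 1) (by lia), Submodule.mem_bot] at mem
    exact Subtype.ext mem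
  have commutator : f * g - g * f = ((1 : k) - (n - 1 : ℕ)) • g := LinearMap.ext fun v =>
    Subtype.ext <| by simpa [f, g, restricted] using D.op_comm 1 (n - 1) (v : W)
  have nonzero : (1 : k) - (n - 1 : ℕ) ≠ 0 := sub_ne_zero.2 (by
    exact_mod_cast show (1 : ℕ) ≠ n - 1 by lia)
  obtain ⟨m, hm⟩ := isNilpotent_of_commutator_eq_smul nonzero commutator
  obtain ⟨v, hv⟩ := exists_ne (0 : lowDegree D.op n)
  have injective_pow : Function.Injective ⇑(g ^ m) := by
    rw [Module.End.coe_pow]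
    exact injective.iterate m
  exact hv (injective_pow (by rw [hm, LinearMap.zero_apply, LinearMap.zero_apply]))

/-- `op 0 - ∂` commutes with all the `op a`, so it has a common eigenvector with `op 1` in the
finite-dimensional space `lowDegree 2`. -/
theorem exists_isDensity [IsAlgClosed k] [CharZero k] [Module.Finite k[X] W] [Nontrivial W]
    (faithful : lowDegree D.op 0 = ⊥) : ∃ u ≠ 0, ∃ α Δ, D.IsDensity α Δ u := by
  have := D.isConformal.finiteDimensional_lowDegree faithful 2
  have := Submodule.nontrivial_iff_ne_bot.2 (D.lowDegree_two_ne_bot faithful)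
  let T : Module.End k W := D.op 0 - Algebra.lsmul k k W (X : k[X])
  have op_T (a : ℕ) (v : W) : D.op a (T v) = T (D.op a v) := by
    have h := D.op_comm a 0 v
    simp only [T, LinearMap.sub_apply, Algebra.lsmul_coe, map_sub, D.isConformal.X_smul]
    rw [Nat.cast_zero, sub_zero, add_zero, sub_eq_iff_eq_add] at h
    rw [h]
    abel
  have T_mem (v : W) (hv : v ∈ lowDegree D.op 2) : T v ∈ lowDegree D.op 2 :=
    mem_lowDegree.2 fun a ha => by rw [op_T, mem_lowDegree.1 hv a ha, map_zero]
  let f := T.restrict T_mem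
  let g := (D.op 1).restrict fun v hv => D.op_mem_lowDegree (n := 2) le_rfl hv
  have commute : Commute f g := LinearMap.ext fun v => Subtype.ext (op_T 1 v).symm
  obtain ⟨⟨u, hu⟩, hu0, α, Δ, hα, hΔ⟩ := exists_common_eigenvector commute
  refine ⟨u, fun h0 => hu0 (Subtype.ext h0), α, Δ, ?_⟩
  have zero : D.op 0 u - (X : k[X]) • u = α • u := congrArg Subtype.val hα
  exact
    { one := congrArg Subtype.val hΔ
      two_le := mem_lowDegree.1 hu
      zero := by rw [add_smul, C_smul_eq, ← zero, add_sub_cancel] }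

/-- A vector that generates a trivial Virasoro module or a quotient of a tensor density module. -/
def IsStandard (u : W) : Prop := u ∈ D.trivialPart ∨ ∃ α Δ, D.IsDensity α Δ u

theorem exists_isStandard [IsAlgClosed k] [CharZero k] [Module.Finite k[X] W] [Nontrivial W] :
    ∃ u ≠ 0, D.IsStandard u := by
  by_cases faithful : lowDegree D.op 0 = ⊥
  · obtain ⟨u, hu0, hu⟩ := D.exists_isDensity faithful
    exact ⟨u, hu0, .inr hu⟩
  · obtain ⟨u, hu, hu0⟩ := (Submodule.ne_bot_iff _).1 faithful
    exact ⟨u, hu0, .inl fun a => mem_lowDegree.1 hu a a.zero_le⟩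

/-- A `k[∂]`-submodule that is stable under the Virasoro action. -/
def IsStable (I : Submodule k[X] W) : Prop := I ≤ D.isConformal.comap I

/-- The Virasoro action on the quotient by a stable submodule. -/
noncomputable def quotient (I : Submodule k[X] W) (hI : D.IsStable I) :
    VirasoroAction k (W ⧸ I) where
  op a := (Submodule.Quotient.restrictScalarsEquiv k I).toLinearMap ∘ₗ
    (I.restrictScalars k).mapQ (I.restrictScalars k) (D.op a) (fun _ hv => hI hv a) ∘ₗ
    (Submodule.Quotient.restrictScalarsEquiv k I).symm.toLinearMap
  isConformal :=
    { X_smul := fun a v => by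
        obtain ⟨v, rfl⟩ := I.mkQ_surjective v
        exact congrArg I.mkQ (D.isConformal.X_smul a v)
      locallyFinite := fun v => by
        obtain ⟨v, rfl⟩ := I.mkQ_surjective v
        obtain ⟨N, hN⟩ := D.isConformal.locallyFinite v
        exact ⟨N, fun a ha => (congrArg I.mkQ (hN a ha)).trans (map_zero _)⟩ }
  op_comm a b v := by
    obtain ⟨v, rfl⟩ := I.mkQ_surjective v
    exact congrArg I.mkQ (D.op_comm a b v)

variable {D}

theorem IsStable.comap_mkQ {I : Submodule k[X] W} {hI : D.IsStable I} {J : Submodule k[X] (W ⧸ I)}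
    (hJ : (D.quotient I hI).IsStable J) : D.IsStable (J.comap I.mkQ) :=
  fun _ hv a => hJ hv a

theorem IsStandard.isStable_span_singleton {u : W} (hu : D.IsStandard u) :
    D.IsStable (Submodule.span k[X] {u}) := by
  refine (Submodule.span_singleton_le_iff_mem _ _).2 fun a => ?_
  rcases hu with hu | ⟨α, Δ, hu⟩
  · rw [mem_trivialPart.1 hu a]
    exact Submodule.zero_mem _
  · match a with
    | 0 =>
      rw [hu.zero]
      exact Submodule.smul_mem _ _ (Submodule.mem_span_singleton_self u)
    | 1 =>
      rw [hu.one, ← C_smul_eq]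
      exact Submodule.smul_mem _ _ (Submodule.mem_span_singleton_self u)
    | a + 2 =>
      rw [hu.two_le _ (Nat.le_add_left 2 a)]
      exact Submodule.zero_mem _

variable (D) in
theorem induction_top [IsAlgClosed k] [CharZero k] [Module.Finite k[X] W]
    {P : Submodule k[X] W → Prop} (bot : P ⊥)
    (step : ∀ (I : Submodule k[X] W) (hI : D.IsStable I) (u : W ⧸ I),
      (D.quotient I hI).IsStandard u → P I → P ((Submodule.span k[X] {u}).comap I.mkQ)) : P ⊤ := by
  obtain ⟨I, ⟨hI, hPI⟩, maximal⟩ := (wellFounded_gt (α := Submodule k[X] W)).has_min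
    {I | D.IsStable I ∧ P I} ⟨⊥, bot_le, bot⟩
  rcases eq_or_ne I ⊤ with rfl | hne
  · exact hPI
  have := Submodule.Quotient.nontrivial_iff.2 hne
  obtain ⟨u, hu0, hu⟩ := (D.quotient I hI).exists_isStandard
  refine absurd ?_ (maximal _ ⟨IsStable.comap_mkQ hu.isStable_span_singleton, step I hI u hu hPI⟩)
  refine lt_of_le_of_ne (Submodule.le_comap_mkQ I _) fun heq => hu0 ?_
  obtain ⟨v, rfl⟩ := I.mkQ_surjective u
  have hv : v ∈ I := heq ▸ Submodule.mem_span_singleton_self (I.mkQ v)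
  exact (Submodule.Quotient.mk_eq_zero I).2 hv

end VirasoroAction

end VirasoroActions

section Strings

open Filter

variable {k : Type*} [Field k] {W : Type*} [AddCommGroup W] [Module k W] [Module k[X] W]

namespace VirasoroAction

/-- The relations between the coefficients `w b = φ b u` of `φ_λ u`, where `u` is primary of weight
`Δ` and `φ` is a primary map of degree `q` with values in `W`. -/
structure IsString (D : VirasoroAction k W) (Δ q : k) (w : ℕ → W) : Prop where
  one (b : ℕ) : D.op 1 (w b) = (Δ + q - b) • w b
  two (b : ℕ) : D.op 2 (w b) = (2 * q - b) • w (b + 1)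
  three (b : ℕ) : D.op 3 (w b) = (3 * q - b) • w (b + 2)

variable {D : VirasoroAction k W}

theorem IsString.mkQ [IsScalarTower k k[X] W] {Δ q : k} {w : ℕ → W} (hw : D.IsString Δ q w)
    {I : Submodule k[X] W} (hI : D.IsStable I) :
    (D.quotient I hI).IsString Δ q fun b => I.mkQ (w b) where
  one b := congrArg I.mkQ (hw.one b)
  two b := congrArg I.mkQ (hw.two b)
  three b := congrArg I.mkQ (hw.three b)

theorem IsString.eq_zero_of_mem_trivialPart [IsScalarTower k k[X] W] {Δ q : k} {w : ℕ → W}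
    (hw : D.IsString Δ q w) (trivial : ∀ b, w b ∈ D.trivialPart) (h0 : q ≠ -Δ) (h1 : q ≠ Δ - 1)
    (b : ℕ) : w b = 0 := by
  by_contra hb
  have weight : Δ + q - b = 0 := by
    have h := hw.one b
    rw [mem_trivialPart.1 (trivial b), eq_comm, smul_eq_zero] at h
    exact h.resolve_right hb
  match b with
  | 0 => exact h0 (by linear_combination weight - (Nat.cast_zero (R := k)))
  | b + 1 =>
    have h := hw.two b
    rw [mem_trivialPart.1 (trivial b), eq_comm, smul_eq_zero] at h
    refine h1 ?_
    push_cast at weight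
    linear_combination h.resolve_right hb - weight

namespace IsDensity

variable {α Δ : k} {u : W} (hu : D.IsDensity α Δ u)
include hu

variable [IsScalarTower k k[X] W]

theorem op_zero_pow_smul (n : ℕ) :
    D.op 0 ((X + C α : k[X]) ^ n • u) = (X + C α : k[X]) ^ (n + 1) • u := by
  induction n with
  | zero => simpa using hu.zero
  | succ n ih =>
    rw [pow_succ', mul_smul, D.isConformal.X_add_C_smul, ih, Nat.cast_zero, zero_smul, add_zero,
      ← mul_smul, ← pow_succ']

theorem op_one_pow_smul (n : ℕ) :
    D.op 1 ((X + C α : k[X]) ^ n • u) = (n + Δ) • (X + C α : k[X]) ^ n • u := by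
  induction n with
  | zero => simpa using hu.one
  | succ n ih =>
    rw [pow_succ', mul_smul, D.isConformal.X_add_C_smul, ih, hu.op_zero_pow_smul,
      smul_comm (X + C α : k[X]), ← mul_smul, ← pow_succ', ← add_smul]
    push_cast
    ring_nf

theorem op_two_pow_smul (n : ℕ) :
    D.op 2 ((X + C α : k[X]) ^ (n + 1) • u) =
      ((n + 1) * (n + 2 * Δ)) • (X + C α : k[X]) ^ n • u := by
  induction n with
  | zero =>
    rw [pow_succ', mul_smul, D.isConformal.X_add_C_smul, hu.op_one_pow_smul, pow_zero, one_smul,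
      hu.two_le 2 le_rfl, smul_zero, zero_add, smul_smul]
    push_cast
    ring_nf
  | succ n ih =>
    rw [pow_succ', mul_smul, D.isConformal.X_add_C_smul, ih, hu.op_one_pow_smul,
      smul_comm (X + C α : k[X]), ← mul_smul, ← pow_succ', smul_smul, ← add_smul]
    push_cast
    ring_nf

theorem op_three_pow_smul (n : ℕ) :
    D.op 3 ((X + C α : k[X]) ^ (n + 2) • u) =
      ((n + 1) * (n + 2) * (n + 3 * Δ)) • (X + C α : k[X]) ^ n • u := by
  induction n with
  | zero =>
    rw [pow_succ', mul_smul, D.isConformal.X_add_C_smul, hu.op_two_pow_smul, pow_one,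
      D.isConformal.X_add_C_smul, hu.two_le 3 (by lia), hu.two_le 2 le_rfl]
    simp only [smul_zero, add_zero, zero_add, smul_smul, pow_zero, one_smul]
    push_cast
    ring_nf
  | succ n ih =>
    rw [pow_succ', mul_smul, D.isConformal.X_add_C_smul, ih, hu.op_two_pow_smul,
      smul_comm (X + C α : k[X]), ← mul_smul, ← pow_succ', smul_smul, ← add_smul]
    push_cast
    ring_nf

theorem hasEigenvector_pow_smul [CharZero k] (nontrivial : u ∉ D.trivialPart) (n : ℕ) :
    (D.op 1).HasEigenvector (n + Δ) ((X + C α : k[X]) ^ n • u) := by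
  refine ⟨Module.End.mem_eigenspace_iff.2 (hu.op_one_pow_smul n), fun h0 => ?_⟩
  have moved : ∃ a, D.op a u ≠ 0 := not_forall.1 (mt mem_trivialPart.2 nontrivial)
  obtain ⟨N, hN⟩ := D.isConformal.exists_hasDegree moved
  refine (D.isConformal.hasDegree_X_add_C_pow_smul hN α n).1 ?_
  rw [h0, map_zero]

end IsDensity

end VirasoroAction

/-- Composing the relations in the two possible orders eliminates `x 0`, and then `x 1`; for
`t ≥ 2` one of the two coefficients on the left is nonzero because
`3 (t - 1 + 2 Δ) - 2 (t - 2 + 3 Δ) = t + 1`. -/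
theorem string_coefficient_eq_zero [CharZero k] {d : ℕ} (hd : 3 ≤ d) {Δ r s : k} {x : ℕ → k}
    (two : ∀ t : ℕ, t + 1 ≤ d → (t + 1) * (t + 2 * Δ) * x (t + 1) = (s + t + 1) * x t)
    (three : ∀ t : ℕ, t + 2 ≤ d → (t + 1) * (t + 2) * (t + 3 * Δ) * x (t + 2) = (r + t + 2) * x t)
    (generic₀ : 3 * (s + 1) * (s + 2) ≠ 2 * (1 + 2 * Δ) * (r + 2))
    (generic₁ : (s + 2) * (s + 3) ≠ 2 * (r + 3)) {t : ℕ} (ht : t ≤ d) : x t = 0 := by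
  have two₀ := two 0 (by lia)
  have two₁ := two 1 (by lia)
  have two₂ := two 2 (by lia)
  have three₀ := three 0 (by lia)
  have three₁ := three 1 (by lia)
  norm_num at two₀ two₁ two₂ three₀ three₁
  have x_zero : x 0 = 0 := by
    refine (mul_eq_zero.1 ?_).resolve_left (sub_ne_zero.2 generic₀)
    linear_combination 2 * (1 + 2 * Δ) * three₀ - 6 * Δ * two₁ - 3 * (s + 2) * two₀
  have x_one : x 1 = 0 := by
    by_contra h
    have hΔ : Δ = 0 := by simpa [x_zero, h] using two₀
    subst hΔ
    refine h ((mul_eq_zero.1 ?_).resolve_left (sub_ne_zero.2 generic₁))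
    linear_combination 2 * three₁ - 2 * two₂ - (s + 3) * two₁
  induction t using Nat.strong_induction_on with
  | _ t ih =>
    match t with
    | 0 => exact x_zero
    | 1 => exact x_one
    | t + 2 =>
      by_contra h
      have ne₁ : (t + 1 : k) ≠ 0 := Nat.cast_add_one_ne_zero t
      have ne₂ : (t + 2 : k) ≠ 0 := by exact_mod_cast (t + 1).succ_ne_zero
      have ne₃ : (t + 3 : k) ≠ 0 := by exact_mod_cast (t + 2).succ_ne_zero
      have h2 := two (t + 1) (by lia)
      have h3 := three t ht
      rw [ih (t + 1) (by lia) (by lia), mul_zero] at h2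
      rw [ih t (by lia) (by lia), mul_zero] at h3
      have factor₂ : (t + 1 + 2 * Δ : k) = 0 := by
        push_cast [add_assoc, one_add_one_eq_two] at h2
        simpa only [mul_eq_zero, h, ne₂, or_false, false_or, add_assoc] using h2
      have factor₃ : (t + 3 * Δ : k) = 0 := by
        simpa only [mul_eq_zero, h, ne₁, ne₂, or_false, false_or] using h3
      exact ne₃ (by linear_combination 3 * factor₂ - 2 * factor₃)

namespace VirasoroAction

variable [IsScalarTower k k[X] W] [CharZero k] {D : VirasoroAction k W} {Δ q : k} {w : ℕ → W}

theorem IsString.exists_coefficients (hw : D.IsString Δ q w) {α Δ' : k} {u : W}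
    (hu : D.IsDensity α Δ' u) (nontrivial : u ∉ D.trivialPart)
    (hwu : ∀ b, w b ∈ Submodule.span k[X] {u}) {b : ℕ} (hb : w b ≠ 0) :
    ∃ d : ℕ, d = Δ + q - Δ' ∧ b ≤ d ∧
      ∃ x : ℕ → k, ∀ t ≤ d, w (d - t) = x t • (X + C α : k[X]) ^ t • u := by
  have injective : Function.Injective fun n : ℕ => n + Δ' :=
    (add_left_injective Δ').comp Nat.cast_injective
  have eigen {b : ℕ} (hb : w b ≠ 0) := exists_mem_span_singleton_of_mem_span_eigenvectors injective
    (hu.hasEigenvector_pow_smul nontrivial) (mem_span_X_add_C_pow_smul α (hwu b)) hb (hw.one b)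
  obtain ⟨n, hn, -⟩ := eigen hb
  have degree : ((b + n : ℕ) : k) = Δ + q - Δ' := by
    push_cast
    linear_combination -hn
  refine ⟨b + n, degree, Nat.le_add_right b n, ?_⟩
  have proportional (t : ℕ) :
      ∃ c : k, t ≤ b + n → w (b + n - t) = c • (X + C α : k[X]) ^ t • u := by
    by_cases h0 : w (b + n - t) = 0
    · exact ⟨0, fun _ => by rw [h0, zero_smul]⟩
    obtain ⟨m, hm, hmem⟩ := eigen h0
    obtain ⟨c, hc⟩ := Submodule.mem_span_singleton.1 hmem
    refine ⟨c, fun ht => ?_⟩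
    rw [Nat.cast_sub ht, degree] at hm
    rw [← hc, (Nat.cast_injective (by linear_combination hm) : t = m)]
  choose x hx using proportional
  exact ⟨x, hx⟩

theorem IsString.eq_zero_of_isDensity (hw : D.IsString Δ q w) {α Δ' : k} {u : W}
    (hu : D.IsDensity α Δ' u) (nontrivial : u ∉ D.trivialPart)
    (hwu : ∀ b, w b ∈ Submodule.span k[X] {u}) (h0 : q ≠ Δ' - Δ) (h1 : q ≠ Δ' - Δ + 1)
    (h2 : q ≠ Δ' - Δ + 2)
    (generic₀ : 3 * (q + (Δ' - Δ) + 1) * (q + (Δ' - Δ) + 2) ≠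
      2 * (1 + 2 * Δ') * (2 * q + (Δ' - Δ) + 2))
    (generic₁ : (q + (Δ' - Δ) + 2) * (q + (Δ' - Δ) + 3) ≠ 2 * (2 * q + (Δ' - Δ) + 3)) (b : ℕ) :
    w b = 0 := by
  by_contra hb
  obtain ⟨d, degree, hbd, x, hx⟩ := hw.exists_coefficients hu nontrivial hwu hb
  have three_le : 3 ≤ d := by
    by_contra! hd
    interval_cases d
    · exact h0 (by push_cast at degree; linear_combination -degree)
    · exact h1 (by push_cast at degree; linear_combination -degree)
    · exact h2 (by push_cast at degree; linear_combination -degree)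
  have cancel (t : ℕ) : Function.Injective fun c : k => c • (X + C α : k[X]) ^ t • u :=
    smul_left_injective k (hu.hasEigenvector_pow_smul nontrivial t).2
  have two (t : ℕ) (ht : t + 1 ≤ d) :
      (t + 1) * (t + 2 * Δ') * x (t + 1) = (q + (Δ' - Δ) + t + 1) * x t := by
    have h := hw.two (d - (t + 1))
    rw [hx _ ht, map_smul, hu.op_two_pow_smul, show d - (t + 1) + 1 = d - t by lia,
      hx t (by lia), smul_smul, smul_smul, Nat.cast_sub ht, degree] at h
    have := cancel t h
    push_cast at this
    linear_combination this
  have three (t : ℕ) (ht : t + 2 ≤ d) :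
      (t + 1) * (t + 2) * (t + 3 * Δ') * x (t + 2) = (2 * q + (Δ' - Δ) + t + 2) * x t := by
    have h := hw.three (d - (t + 2))
    rw [hx _ ht, map_smul, hu.op_three_pow_smul, show d - (t + 2) + 2 = d - t by lia,
      hx t (by lia), smul_smul, smul_smul, Nat.cast_sub ht, degree] at h
    have := cancel t h
    push_cast at this
    linear_combination this
  have vanish : x (d - b) = 0 :=
    string_coefficient_eq_zero three_le two three generic₀ generic₁ (Nat.sub_le d b)
  have h := hx (d - b) (Nat.sub_le d b)
  rw [vanish, zero_smul, Nat.sub_sub_self hbd] at h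
  exact hb h

theorem IsStandard.eventually_string_eq_zero {u : W} (hu : D.IsStandard u) (Δ : k) :
    ∀ᶠ q in cofinite, ∀ w, D.IsString Δ q w → (∀ b, w b ∈ Submodule.span k[X] {u}) →
      ∀ b, w b = 0 := by
  have ne (c : k) : ∀ᶠ q in cofinite, q ≠ c := by simp
  by_cases htriv : u ∈ D.trivialPart
  · filter_upwards [ne (-Δ), ne (Δ - 1)] with q h0 h1 w hw hwu
    exact hw.eq_zero_of_mem_trivialPart
      (fun b => (Submodule.span_singleton_le_iff_mem _ _).2 htriv (hwu b)) h0 h1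
  obtain ⟨α, Δ', hu⟩ := hu.resolve_left htriv
  let γ := Δ' - Δ
  filter_upwards [ne γ, ne (γ + 1), ne (γ + 2),
    eventually_quadratic_ne_zero (three_ne_zero (α := k)) (6 * γ + 9 - 4 * (1 + 2 * Δ'))
      (3 * (γ + 1) * (γ + 2) - 2 * (1 + 2 * Δ') * (γ + 2)),
    eventually_quadratic_ne_zero (one_ne_zero (α := k)) (2 * γ + 1)
      ((γ + 2) * (γ + 3) - 2 * (γ + 3))] with q h0 h1 h2 generic₀ generic₁ w hw hwu
  exact hw.eq_zero_of_isDensity hu htriv hwu h0 h1 h2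
    (fun h => generic₀ (by linear_combination h)) fun h => generic₁ (by linear_combination h)

theorem eventually_string_eq_zero [IsAlgClosed k] [Module.Finite k[X] W] (D : VirasoroAction k W)
    (Δ : k) : ∀ᶠ q in cofinite, ∀ w, D.IsString Δ q w → ∀ b, w b = 0 := by
  have strings_in_top : ∀ᶠ q in cofinite, ∀ w, D.IsString Δ q w →
      (∀ b, w b ∈ (⊤ : Submodule k[X] W)) → ∀ b, w b = 0 := by
    refine D.induction_top (P := fun I => ∀ᶠ q in cofinite, ∀ w, D.IsString Δ q w →
      (∀ b, w b ∈ I) → ∀ b, w b = 0) (.of_forall fun q w _ hw => hw) fun I hI u hu hPI => ?_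
    filter_upwards [hPI, hu.eventually_string_eq_zero Δ] with q hq hqu w hw hwu
    exact hq w hw fun b => (Submodule.Quotient.mk_eq_zero I).1 (hqu _ (hw.mkQ hI) hwu b)
  filter_upwards [strings_in_top] with q hq w hw
  exact hq w hw fun _ => Submodule.mem_top

end VirasoroAction

end Strings

section PrimaryMaps

open Filter

variable {k : Type*} [Field k] {V W : Type*} [AddCommGroup V] [Module k V] [Module k[X] V]
  [AddCommGroup W] [Module k W] [Module k[X] W]

/-- A conformal linear map that is a primary vector of weight `q + 1` for the Virasoro action on the
conformal linear maps from `V` to `W`. -/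
structure IsPrimaryMap (D : VirasoroAction k V) (E : VirasoroAction k W) (q : k)
    (φ : ℕ → V →ₗ[k] W) : Prop extends IsConformalLinearMap φ where
  comm (a b : ℕ) (v : V) :
    E.op a (φ b v) - φ b (D.op a v) = (q * a - b) • φ (a + b - 1) v

namespace IsPrimaryMap

variable [IsScalarTower k k[X] V] {D : VirasoroAction k V} {E : VirasoroAction k W} {q : k}
  {φ : ℕ → V →ₗ[k] W}

theorem isString (hφ : IsPrimaryMap D E q φ) {I : Submodule k[X] V} {hI : D.IsStable I}
    (kills : ∀ v ∈ I, ∀ b, φ b v = 0) {Δ : k} {u : V}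
    (hu : (D.quotient I hI).IsPrimary Δ (I.mkQ u)) : E.IsString Δ q fun b => φ b u := by
  have congr {v v' : V} (h : I.mkQ v = I.mkQ v') (b : ℕ) : φ b v = φ b v' :=
    sub_eq_zero.1 ((map_sub _ _ _).symm.trans (kills _ ((Submodule.Quotient.eq I).1 h) b))
  have op_one (b : ℕ) : φ b (D.op 1 u) = Δ • φ b u := by
    rw [← map_smul]
    exact congr hu.one b
  have op_two_le (a : ℕ) (ha : 2 ≤ a) (b : ℕ) : φ b (D.op a u) = 0 :=
    kills _ ((Submodule.Quotient.mk_eq_zero I).1 (hu.two_le a ha)) b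
  refine ⟨fun b => ?_, fun b => ?_, fun b => ?_⟩
  · have h := hφ.comm 1 b u
    rw [op_one, sub_eq_iff_eq_add, Nat.add_sub_cancel_left, ← add_smul] at h
    simpa only [Nat.cast_one, mul_one, sub_add_eq_add_sub, add_comm q] using h
  · have h := hφ.comm 2 b u
    rw [op_two_le 2 le_rfl, sub_zero, show 2 + b - 1 = b + 1 by lia] at h
    simpa only [Nat.cast_ofNat, mul_comm q] using h
  · have h := hφ.comm 3 b u
    rw [op_two_le 3 (by lia), sub_zero, show 3 + b - 1 = b + 2 by lia] at h
    simpa only [Nat.cast_ofNat, mul_comm q] using h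

end IsPrimaryMap

theorem VirasoroAction.IsStandard.exists_isPrimary [IsScalarTower k k[X] V]
    {D : VirasoroAction k V} {u : V} (hu : D.IsStandard u) : ∃ Δ, D.IsPrimary Δ u := by
  rcases hu with hu | ⟨α, Δ, hu⟩
  · exact ⟨0, VirasoroAction.isPrimary_of_mem_trivialPart hu⟩
  · exact ⟨Δ, hu.toIsPrimary⟩

theorem eventually_primaryMap_eq_zero [IsAlgClosed k] [CharZero k] [IsScalarTower k k[X] V]
    [IsScalarTower k k[X] W] [Module.Finite k[X] V] [Module.Finite k[X] W]
    (D : VirasoroAction k V) (E : VirasoroAction k W) :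
    ∀ᶠ q in cofinite, ∀ φ : ℕ → V →ₗ[k] W, IsPrimaryMap D E q φ → ∀ b, φ b = 0 := by
  have kills_top : ∀ᶠ q in cofinite, ∀ φ : ℕ → V →ₗ[k] W, IsPrimaryMap D E q φ →
      ∀ v ∈ (⊤ : Submodule k[X] V), ∀ b, φ b v = 0 := by
    refine D.induction_top (P := fun I => ∀ᶠ q in cofinite, ∀ φ : ℕ → V →ₗ[k] W,
      IsPrimaryMap D E q φ → ∀ v ∈ I, ∀ b, φ b v = 0) (.of_forall fun q φ _ v hv b => ?_)
      fun I hI u hu hPI => ?_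
    · rw [(Submodule.mem_bot _).1 hv, map_zero]
    obtain ⟨Δ, hΔ⟩ := hu.exists_isPrimary
    obtain ⟨u, rfl⟩ := I.mkQ_surjective u
    filter_upwards [hPI, E.eventually_string_eq_zero Δ] with q hq hqE φ hφ v hv b
    have kills_u : u ∈ hφ.toIsConformalLinearMap.comap ⊥ := hqE _ (hφ.isString (hq φ hφ) hΔ)
    obtain ⟨f, hf⟩ := Submodule.mem_span_singleton.1 hv
    have difference : v - f • u ∈ I :=
      (Submodule.Quotient.eq I).1 (by rw [Submodule.Quotient.mk_smul]; exact hf.symm)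
    rw [← sub_add_cancel v (f • u), map_add, hq φ hφ _ difference, zero_add]
    exact Submodule.smul_mem _ f kills_u b
  filter_upwards [kills_top] with q hq φ hφ b
  exact LinearMap.ext fun v => hq φ hφ v Submodule.mem_top b

end PrimaryMaps

section Modes

theorem eval_zero_iterate_derivative_comp_X_add_C {R : Type*} [CommRing R] (p : R[X]) (r : R)
    (n : ℕ) : (derivative^[n] (p.comp (X + C r))).eval 0 = (derivative^[n] p).eval r := by
  have shift : ∀ q : R[X], derivative (q.comp (X + C r)) = (derivative q).comp (X + C r) :=
    fun q => by simp [derivative_comp]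
  have commute : Function.Commute derivative fun q : R[X] => q.comp (X + C r) := shift
  rw [(commute.iterate_left n) p, eval_comp, eval_add, eval_X, eval_C, zero_add]

theorem natCast_mul_eval_iterate_derivative_pred_add {R : Type*} [Semiring R] (p : R[X]) (x : R)
    (i j : ℕ) : (i : R) * (derivative^[i - 1 + j] p).eval x =
      i * (derivative^[i + j - 1] p).eval x := by
  cases i with
  | zero => simp
  | succ i => rw [show i + 1 - 1 + j = i + 1 + j - 1 by lia]

namespace LambdaPoly

variable {U : Type*} [AddCommGroup U] [Module ℂ U] [Module ℂ[X] U]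

/-- The coefficient of `λⁿ / n!`, so that `a_λ v` has the modes `a_(n) v` usual in the theory of
vertex algebras. -/
noncomputable def mode (n : ℕ) : LambdaPoly U →ₗ[ℂ] U :=
  (n.factorial : ℂ) •
    (Finsupp.lapply n ∘ₗ (PolynomialModule.coeffLinearEquiv ℂ[X] ℂ).toLinearMap)

theorem mode_apply (n : ℕ) (P : LambdaPoly U) : mode n P = (n.factorial : ℂ) • P.coeff n := rfl

theorem eq_zero_of_mode_eq_zero {P : LambdaPoly U} (hP : ∀ n, mode n P = 0) : P = 0 := by
  ext n
  exact (smul_eq_zero.1 (hP n)).resolve_left (Nat.cast_ne_zero.2 n.factorial_ne_zero)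

theorem exists_mode_eq_zero (P : LambdaPoly U) : ∃ N, ∀ n ≥ N, mode n P = 0 := by
  obtain ⟨N, hN⟩ := P.coeff.support.bddAbove
  refine ⟨N + 1, fun n hn => ?_⟩
  have : P.coeff n = 0 := Finsupp.notMem_support_iff.1 fun h => by
    have := hN h
    lia
  rw [mode_apply, this, smul_zero]

theorem mode_X_smul (n : ℕ) (P : LambdaPoly U) :
    mode n ((X : ℂ[X][X]) • P) = (n : ℂ) • mode (n - 1) P := by
  rw [← monomial_one_one_eq_X, mode_apply, mode_apply, PolynomialModule.monomial_smul_apply]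
  cases n with
  | zero => simp
  | succ n =>
    rw [if_pos (by lia), one_smul, Nat.add_sub_cancel, smul_smul, Nat.factorial_succ, Nat.cast_mul]

/-- The complex polynomial obtained from an element of `U[λ]` by applying a linear functional of `U`
to its coefficients. -/
noncomputable def pairing (f : Module.Dual ℂ U) : LambdaPoly U →ₗ[ℂ] ℂ[X] :=
  Finsupp.lsum ℂ (fun n => (monomial n).comp f) ∘ₗ
    (PolynomialModule.coeffLinearEquiv ℂ[X] ℂ).toLinearMap

theorem pairing_single (f : Module.Dual ℂ U) (n : ℕ) (u : U) :
    pairing f (PolynomialModule.single ℂ[X] n u) = monomial n (f u) := by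
  simp [pairing]

theorem coeff_pairing (f : Module.Dual ℂ U) (P : LambdaPoly U) (n : ℕ) :
    (pairing f P).coeff n = f (P.coeff n) := by
  induction P using PolynomialModule.induction_linear with
  | zero => simp
  | add P Q hP hQ => simp [hP, hQ]
  | single m u => simp [pairing_single, coeff_monomial, Finsupp.single_apply, apply_ite f]

theorem eval_zero_iterate_derivative_pairing (f : Module.Dual ℂ U) (n : ℕ) (P : LambdaPoly U) :
    (derivative^[n] (pairing f P)).eval 0 = f (mode n P) := by
  rw [← coeff_zero_eq_eval_zero, coeff_iterate_derivative, zero_add, Nat.descFactorial_self,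
    coeff_pairing, mode_apply, map_smul, nsmul_eq_mul, smul_eq_mul]

variable [IsScalarTower ℂ ℂ[X] U]

theorem mode_C_smul (n : ℕ) (f : ℂ[X]) (P : LambdaPoly U) :
    mode n ((C f : ℂ[X][X]) • P) = f • mode n P := by
  rw [← monomial_zero_left, mode_apply, mode_apply, PolynomialModule.monomial_smul_apply]
  simp [smul_comm _ f]

theorem eval_pairing (f : Module.Dual ℂ U) (l : ℂ) (P : LambdaPoly U) :
    (pairing f P).eval l = f (evalAt l P) := by
  induction P using PolynomialModule.induction_linear with
  | zero => simp
  | add P Q hP hQ => simp only [map_add, eval_add, hP, hQ]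
  | single n u =>
    rw [pairing_single, eval_monomial, evalAt, PolynomialModule.eval_single, ← C_pow, C_smul_eq,
      map_smul, smul_eq_mul, mul_comm]

theorem mode_commutator {α β γ : U →ₗ[ℂ] LambdaPoly U} {κ ν : ℂ}
    (h : ∀ (l m : ℂ) (v : U), evalAt l (α (evalAt m (β v))) - evalAt m (β (evalAt l (α v))) =
      (κ * l - ν * m) • evalAt (l + m) (γ v)) (i j : ℕ) (v : U) :
    mode i (α (mode j (β v))) - mode j (β (mode i (α v))) =
      (κ * i - ν * j) • mode (i + j - 1) (γ v) := by
  -- Take modes in `μ` for a fixed value of `λ` first, and then modes in `λ`.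
  rw [← sub_eq_zero, ← Module.forall_dual_apply_eq_zero_iff ℂ]
  intro f
  set Q := pairing f (γ v) with hQ
  have inner (l : ℂ) : pairing (f ∘ₗ (evalAt l).restrictScalars ℂ ∘ₗ α) (β v) -
      pairing f (β (evalAt l (α v))) =
        C (κ * l) * Q.comp (X + C l) - C ν * (Q.comp (X + C l) * X) := by
    refine Polynomial.funext fun m => ?_
    have hf := congrArg f (h l m v)
    rw [map_sub, map_smul, smul_eq_mul] at hf
    simp only [eval_sub, eval_mul, eval_C, eval_X, eval_comp, eval_add, eval_pairing,
      LinearMap.comp_apply, LinearMap.restrictScalars_apply, hf, hQ, add_comm m l]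
    ring
  have inner_mode (l : ℂ) : f (evalAt l (α (mode j (β v)))) - f (mode j (β (evalAt l (α v)))) =
      κ * l * (derivative^[j] Q).eval l - ν * (j * (derivative^[j - 1] Q).eval l) := by
    have := congrArg (fun P : ℂ[X] => (derivative^[j] P).eval 0) (inner l)
    simpa only [iterate_derivative_sub, iterate_derivative_C_mul, iterate_derivative_mul_X,
      eval_sub, eval_mul, eval_C, eval_add, eval_X, mul_zero, zero_add, nsmul_eq_mul, eval_natCast,
      eval_zero_iterate_derivative_comp_X_add_C, eval_zero_iterate_derivative_pairing,
      LinearMap.comp_apply, LinearMap.restrictScalars_apply] using this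
  have outer : pairing f (α (mode j (β v))) - pairing (f ∘ₗ mode j ∘ₗ β) (α v) =
      C κ * (derivative^[j] Q * X) - C (ν * j) * derivative^[j - 1] Q := by
    refine Polynomial.funext fun l => ?_
    simp only [eval_sub, eval_mul, eval_C, eval_X, eval_pairing, LinearMap.comp_apply, inner_mode]
    ring
  have outer_mode : f (mode i (α (mode j (β v)))) - f (mode j (β (mode i (α v)))) =
      κ * (i * (derivative^[i - 1 + j] Q).eval 0) -
        ν * j * (derivative^[i + (j - 1)] Q).eval 0 := by
    have := congrArg (fun P : ℂ[X] => (derivative^[i] P).eval 0) outer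
    simpa only [iterate_derivative_sub, iterate_derivative_C_mul, iterate_derivative_mul_X,
      eval_sub, eval_mul, eval_C, eval_add, eval_X, mul_zero, zero_add, nsmul_eq_mul, eval_natCast,
      eval_zero_iterate_derivative_pairing, LinearMap.comp_apply,
      ← Function.iterate_add_apply] using this
  rw [map_sub, map_sub, map_smul, smul_eq_mul, outer_mode,
    natCast_mul_eval_iterate_derivative_pred_add, mul_assoc ν, add_comm i (j - 1),
    natCast_mul_eval_iterate_derivative_pred_add, add_comm j i,
    ← eval_zero_iterate_derivative_pairing]
  ring

end LambdaPoly

end Modes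

/-- A primary element of weight `Δ` with respect to `e`: `[e_λ b] = (∂ + Δ λ) b`. A Virasoro element
is an even `e` that is primary of weight `2` with respect to itself. -/
def LieConformalSuperalgebra.IsPrimary {S : Type*} [AddCommGroup S] [Module ℂ S] [Module ℂ[X] S]
    [IsScalarTower ℂ ℂ[X] S] (A : LieConformalSuperalgebra S) (e : S) (Δ : ℂ) (b : S) : Prop :=
  ∀ l, LambdaPoly.evalAt l (A.bracket e b) = (X + C (Δ * l) : ℂ[X]) • b

namespace ConformalModule

open LambdaPoly

variable {S : Type*} [AddCommGroup S] [Module ℂ S] [Module ℂ[X] S] [IsScalarTower ℂ ℂ[X] S]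
  {A : LieConformalSuperalgebra S}
  {V : Type*} [AddCommGroup V] [Module ℂ V] [Module ℂ[X] V] [IsScalarTower ℂ ℂ[X] V]
  (M : ConformalModule A V)

theorem act_smul_left (f : ℂ[X]) (a : S) (v : V) :
    M.act (f • a) v = aeval (-X : ℂ[X][X]) f • M.act a v := by
  induction f using Polynomial.induction_on with
  | C c => rw [C_smul_eq, map_smul, LinearMap.smul_apply, aeval_C, algebraMap_smul]
  | add f g hf hg => rw [add_smul, map_add, LinearMap.add_apply, hf, hg, map_add, add_smul]
  | monomial n c ih =>
    rw [pow_succ', mul_left_comm, mul_smul, M.act_d_left, ih, map_mul (aeval _) X,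
      aeval_X, mul_smul, neg_smul]

theorem evalAt_act_smul_left (l : ℂ) (f : ℂ[X]) (a : S) (v : V) :
    evalAt l (M.act (f • a) v) = f.eval (-l) • evalAt l (M.act a v) := by
  rw [act_smul_left, evalAt, PolynomialModule.eval_smul, BlockS.eval_aeval_left, C_smul_eq]

/-- The elements of the algebra that act by zero. -/
def annihilator : Submodule ℂ[X] S where
  carrier := {a | M.act a = 0}
  add_mem' {a b} (ha : M.act a = 0) (hb : M.act b = 0) := by
    rw [Set.mem_ofPred_eq, map_add, ha, hb, add_zero]
  zero_mem' := map_zero M.act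
  smul_mem' f a (ha : M.act a = 0) := LinearMap.ext fun v => by
    rw [act_smul_left, ha, LinearMap.zero_apply, smul_zero]

/-- The operators `a_(n)`, for which `a_λ v = ∑ n, a_(n) v * λⁿ / n!`. -/
noncomputable def op (a : S) (n : ℕ) : Module.End ℂ V := mode n ∘ₗ M.act a

theorem mem_annihilator_of_op_eq_zero {a : S} (ha : ∀ n, M.op a n = 0) : a ∈ M.annihilator :=
  LinearMap.ext fun v => eq_zero_of_mode_eq_zero fun n => LinearMap.congr_fun (ha n) v

theorem isConformalLinearMap_op (a : S) : IsConformalLinearMap (M.op a) where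
  X_smul n v := by
    simp only [op, LinearMap.comp_apply, M.act_d_right, add_smul, map_add, mode_C_smul, mode_X_smul]
  locallyFinite v := exists_mode_eq_zero (M.act a v)

variable {e : S} (he : e ∈ A.part 0)
include he

theorem op_commutator_of_isPrimary {β : ZMod 2} {b : S} {Δ : ℂ} (hb : b ∈ A.part β)
    (hΔ : A.IsPrimary e Δ b) (i j : ℕ) (v : V) :
    M.op e i (M.op b j v) - M.op b j (M.op e i v) = ((Δ - 1) * i - j) • M.op b (i + j - 1) v := by
  rw [← one_mul (j : ℂ)]
  refine mode_commutator (fun l m v => ?_) i j v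
  have sign : paritySign 0 β = 1 := by rw [paritySign, ZMod.val_zero, zero_mul, pow_zero]
  have h := M.act_bracket 0 β e b v he hb l m
  rw [sign, one_smul, hΔ l, evalAt_act_smul_left, eval_add, eval_X, eval_C] at h
  rw [h]
  congr 1
  ring

/-- The conformal action on `V` of the Virasoro element `e`. -/
noncomputable def virasoroAction (hV : A.IsPrimary e 2 e) : VirasoroAction ℂ V where
  op := M.op e
  isConformal := M.isConformalLinearMap_op e
  op_comm a b v := by
    rw [M.op_commutator_of_isPrimary he he hV]
    congr 1
    ring

theorem isPrimaryMap_op {β : ZMod 2} {b : S} {Δ : ℂ} (hV : A.IsPrimary e 2 e) (hb : b ∈ A.part β)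
    (hΔ : A.IsPrimary e Δ b) :
    IsPrimaryMap (M.virasoroAction he hV) (M.virasoroAction he hV) (Δ - 1) (M.op b) where
  toIsConformalLinearMap := M.isConformalLinearMap_op b
  comm := M.op_commutator_of_isPrimary he hb hΔ

theorem eventually_primary_mem_annihilator [Module.Finite ℂ[X] V] (hV : A.IsPrimary e 2 e) :
    ∀ᶠ Δ in Filter.cofinite, ∀ β, ∀ b ∈ A.part β, A.IsPrimary e Δ b → b ∈ M.annihilator := by
  have generic := eventually_primaryMap_eq_zero (M.virasoroAction he hV) (M.virasoroAction he hV)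
  filter_upwards [(sub_left_injective (b := (1 : ℂ))).tendsto_cofinite.eventually generic] with
    Δ hΔ β b hb hbΔ
  exact M.mem_annihilator_of_op_eq_zero (hΔ _ (M.isPrimaryMap_op he hV hb hbΔ))

omit he

/-- A conformal module on which an ideal acts by zero, as a conformal module over the quotient. -/
noncomputable def ofQuotient (I : Submodule ℂ[X] S) (hI : A.IsIdeal I) (h : I ≤ M.annihilator) :
    ConformalModule (A.quotient I hI) V where
  part := M.part
  isCompl_part := M.isCompl_part
  act := (I.restrictScalars ℂ).liftQ M.act (fun a ha => h ha) ∘ₗ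
    (Submodule.Quotient.restrictScalarsEquiv ℂ I).symm.toLinearMap
  act_mem := by
    rintro α β _ v ⟨a, ha, rfl⟩ hv n
    exact M.act_mem α β a v ha hv n
  act_d_left a v := by
    obtain ⟨a, rfl⟩ := I.mkQ_surjective a
    exact M.act_d_left a v
  act_d_right a v := by
    obtain ⟨a, rfl⟩ := I.mkQ_surjective a
    exact M.act_d_right a v
  act_bracket := by
    rintro α β _ _ v ⟨a, ha, rfl⟩ ⟨b, hb, rfl⟩ l m
    have quotient_bracket : (A.quotient I hI).bracket (I.mkQ a) (I.mkQ b) =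
      LambdaPoly.mk I (A.bracket a b) := hI.bracket_mk a b
    rw [quotient_bracket, evalAt_mk]
    exact M.act_bracket α β a b v ha hb l m

theorem ofQuotient_act_mkQ (I : Submodule ℂ[X] S) (hI : A.IsIdeal I) (h : I ≤ M.annihilator)
    (a : S) (v : V) : (M.ofQuotient I hI h).act (I.mkQ a) v = M.act a v := rfl

end ConformalModule

namespace BlockS

open LambdaPoly

theorem finite_setOf_index_lt (n : ℕ) : {x : Gen | x.index < n}.Finite := by
  refine (((Set.finite_Iio n).image Gen.L).union (((Set.finite_Iio n).image Gen.W).union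
    ((Set.finite_Iio n).image Gen.G))).subset ?_
  rintro (i | i | i) hi
  · exact Or.inl ⟨i, hi, rfl⟩
  · exact Or.inr (Or.inl ⟨i, hi, rfl⟩)
  · exact Or.inr (Or.inr ⟨i, hi, rfl⟩)

theorem finite_quotientCarrier (n : ℕ) : Module.Finite ℂ[X] (QuotientCarrier n) :=
  finite_finsupp_quotient_supported <| by
    simpa only [Set.compl_ofPred, not_le] using finite_setOf_index_lt (n + 1)

theorem tail_le_iff {n : ℕ} {I : Submodule ℂ[X] Carrier} :
    tail n ≤ I ↔ ∀ x : Gen, n ≤ x.index → gen x ∈ I := by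
  rw [tail, Finsupp.supported_eq_span_single, Submodule.span_le, Set.image_subset_iff]
  rfl

/-- The element `p⁻¹ L_0`, which generates a Virasoro conformal algebra in `𝒮(p)`. -/
noncomputable def virasoro (p : ℂ) : Carrier := p⁻¹ • L 0

/-- The weights of the generators with respect to `p⁻¹ L_0`. -/
noncomputable def weight (p : ℂ) : Gen → ℂ
  | .L i => p⁻¹ * i + 2
  | .W i => p⁻¹ * i + 1
  | .G i => p⁻¹ * i + 2

variable {p : ℂ}

theorem virasoro_mem_part (p : ℂ) : virasoro p ∈ (algebra p).part 0 :=
  Submodule.smul_of_tower_mem _ _ (gen_mem_part (.L 0))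

variable (hp : p ≠ 0)
include hp

theorem genBracket_L_zero (x : Gen) :
    genBracket p (.L 0) x = lin p (p * weight p x) (gen x) := by
  cases x <;> simp only [genBracket, weight, L, W, G, Nat.cast_zero, zero_add] <;>
    congr 1 <;> field_simp

theorem isPrimary_gen (x : Gen) : (algebra p).IsPrimary (virasoro p) (weight p x) (gen x) := by
  intro l
  have bracket_L_zero : (algebra p).bracket (L 0) (gen x) = lin p (p * weight p x) (gen x) :=
    (bracket_gen p (.L 0) x).trans (genBracket_L_zero hp x)
  rw [virasoro, map_smul, LinearMap.smul_apply, bracket_L_zero, LinearMap.map_smul_of_tower,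
    evalAt_lin, mul_assoc, C_mul, ← mul_add, mul_smul, C_smul_eq, inv_smul_smul₀ hp]

theorem isPrimary_virasoro : (algebra p).IsPrimary (virasoro p) 2 (virasoro p) := by
  intro l
  have weight_L_zero : weight p (.L 0) = 2 := by simp [weight]
  have h : evalAt l ((algebra p).bracket (virasoro p) (L 0)) = (X + C (2 * l) : ℂ[X]) • L 0 :=
    weight_L_zero ▸ isPrimary_gen hp (.L 0) l
  rw [show virasoro p = p⁻¹ • L 0 from rfl] at h ⊢
  rw [map_smul, LinearMap.map_smul_of_tower, h, smul_comm]

theorem exists_forall_weight_mem {s : Set ℂ} (hs : s ∈ Filter.cofinite) :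
    ∃ N, ∀ x : Gen, N ≤ x.index → weight p x ∈ s := by
  have injective (c : ℂ) : Function.Injective fun i : ℕ => p⁻¹ * (i : ℂ) + c := fun i j hij => by
    simpa [hp] using hij
  have eventually (c : ℂ) : ∀ᶠ i : ℕ in Filter.atTop, p⁻¹ * (i : ℂ) + c ∈ s := by
    rw [← Nat.cofinite_eq_atTop]
    exact (injective c).tendsto_cofinite hs
  obtain ⟨N, hN⟩ := Filter.eventually_atTop.1 ((eventually 1).and (eventually 2))
  refine ⟨N, fun x hx => ?_⟩
  cases x with
  | L i => exact (hN i hx).2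
  | W i => exact (hN i hx).1
  | G i => exact (hN i hx).2

theorem exists_gen_mem_annihilator {V : Type*} [AddCommGroup V] [Module ℂ V] [Module ℂ[X] V]
    [IsScalarTower ℂ ℂ[X] V] [Module.Finite ℂ[X] V] (M : ConformalModule (algebra p) V) :
    ∃ N, ∀ x : Gen, N ≤ x.index → gen x ∈ M.annihilator := by
  obtain ⟨N, hN⟩ := exists_forall_weight_mem hp
    (M.eventually_primary_mem_annihilator (virasoro_mem_part p) (isPrimary_virasoro hp))
  exact ⟨N, fun x hx => hN x hx x.parity _ (gen_mem_part x) (isPrimary_gen hp x)⟩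

end BlockS

theorem mainTheorem5 (p : ℂ) (hp : p ≠ 0) {V : Type*} [AddCommGroup V] [Module ℂ V]
    [Module ℂ[X] V] [IsScalarTower ℂ ℂ[X] V] (hfin : Module.Finite ℂ[X] V)
    (M : ConformalModule (BlockS.algebra p) V) (hM : M.Nontrivial) :
    (∃ N : ℕ, ∀ i ≥ N, ∀ v : V,
      M.act (BlockS.L i) v = 0 ∧ M.act (BlockS.W i) v = 0 ∧ M.act (BlockS.G i) v = 0) ∧
    (∃ N : ℕ, ∀ n ≥ N,
      Module.Finite ℂ[X] (BlockS.QuotientCarrier n) ∧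
      ∃ M' : ConformalModule (BlockS.quotientAlgebra p n) V,
        M'.part = M.part ∧
        ∀ (a : BlockS.Carrier) (v : V),
          M'.act ((BlockS.tail (n + 1)).mkQ a) v = M.act a v) := by
  obtain ⟨N, hN⟩ := BlockS.exists_gen_mem_annihilator hp M
  refine ⟨⟨N, fun i hi v => ⟨?_, ?_, ?_⟩⟩, N, fun n hn => ⟨BlockS.finite_quotientCarrier n, ?_⟩⟩
  · exact LinearMap.congr_fun (hN (.L i) hi) v
  · exact LinearMap.congr_fun (hN (.W i) hi) v
  · exact LinearMap.congr_fun (hN (.G i) hi) v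
  · have tail_acts_by_zero : BlockS.tail (n + 1) ≤ M.annihilator :=
      BlockS.tail_le_iff.2 fun x hx => hN x (by lia)
    exact ⟨M.ofQuotient _ (BlockS.isIdeal_tail p (n + 1)) tail_acts_by_zero, rfl,
      M.ofQuotient_act_mkQ _ _ tail_acts_by_zero⟩
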